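/- Let $\mathcal X$ be a unital $C^*$-algebra, $\mathcal X^{\mathbb R}$ the real space of its self-adjoint elements, and $E$ its state space (positive functionals $\rho\in\mathcal X^*$ with $\rho(\mathfrak 1)=1$) with the weak$^*$ topology. For $A\in\mathcal X$ let $\hat A\in C(E;\mathbb C)$, $\hat A(\rho)=\rho(A)$. Let $\mathfrak C_{\mathcal X}$ be the subalgebra of $C(E;\mathbb C)$ of all polynomials with complex coefficients in the functions $\hat A$, $A\in\mathcal X$ (constants included), and $\mathfrak C_{\mathcal X^{\mathbb R}}$ the one generated by the $\hat A$, $A\in\mathcal X^{\mathbb R}$. For $\mathcal Y\in\{\mathbb R,\mathbb C\}$, a function $f\in C(E;\mathcal Y)$ belongs to $C^1(E;\mathcal Y)$ if for each $\rho\in E$ there is an affine weak$^*$-continuous $\mathrm df(\rho):E\to\mathcal Y$ with $\lim_{\lambda\to0^+}\lambda^{-1}\big(f((1-\lambda)\rho+\lambda\upsilon)-f(\rho)\big)=[\mathrm df(\rho)](\upsilon)$ for all $\upsilon\in E$, and $\rho\mapsto\mathrm df(\rho)$ is continuous for the supremum norm. Then $\mathrm Df(\rho)\in\mathcal X$ denotes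 the unique element with $[\mathrm df(\rho)](\upsilon)=\upsilon(\mathrm Df(\rho))$ for all $\upsilon\in E$, and $\{f,g\}(\rho)=\rho\big(i[\mathrm Df(\rho),\mathrm Dg(\rho)]\big)$. Let $\mathfrak B$ be a finite-dimensional real subspace of $\mathcal X^{\mathbb R}$, and let $h\in C^1(E;\mathbb R)$ (a time-independent Hamiltonian) be such that, for some constant $D_0>0$, $$\|\mathrm Dh(\rho)-\mathrm Dh(\tilde\rho)\|_{\mathcal X}\le D_0\sup_{B\in\mathfrak B,\ \|B\|=1}|(\rho-\tilde\rho)(B)|,\qquad \rho,\tilde\rho\in E.$$ For a continuous curve $\xi:\mathbb R\to E$ let $(T^\xi_{t,s})_{s,t\in\mathbb R}$ be the family of bounded operators on $\mathcal X$ determined by $\partial_tT^\xi_{t,s}=T^\xi_{t,s}\circ X^{\xi(t)}$, $T^\xi_{s,s}=\mathbf 1$, where $X^{\rho}(A)=i[\mathrm Dh(\rho),A]$. Then there is a unique $\varpi^h\in C(\mathbb R^2;\mathrm{Aut}(E))$ ($\mathrm{Aut}(E)$ being the self-homeomorphisms of $E$ with the topology of uniform convergence) such that $\varpi^h(s,t)(\rho)=\rho\circ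 T^{\varpi^h(s,\cdot)(\rho)}_{t,s}$ for all $s,t\in\mathbb R$, $\rho\in E$, and with the $*$-automorphisms $V^h_{t,s}(f)=f\circ\varpi^h(s,t)$ of $C(E;\mathbb C)$ the family $(V^h_{t,0})_{t\in\mathbb R}$ is a $C_0$-group. Let $\daleth^h$ be its generator. Moreover, $\mathfrak d^h(f)=\{h,f\}$ is a well-defined linear operator from $\mathrm{dom}(\mathfrak d^h)=\mathfrak C_{\mathcal X}$ to $C(E;\mathbb C)$, and: (i) $\mathfrak d^h$ is closable. Its closure $\bar{\mathfrak d}^h$ is conservative (i.e. $\pm\bar{\mathfrak d}^h$ are dissipative) and $\bar{\mathfrak d}^h\subseteq\daleth^h$. (ii) If $\beth\supseteq\bar{\mathfrak d}^h$ is a conservative closed operator that generates a $C_0$-group on $C(E;\mathbb C)$, then $\beth=\daleth^h$. (iii) If $h\in\mathfrak C_{\mathcal X^{\mathbb R}}$, then $\bar{\mathfrak d}^h=\daleth^h$, the generator of the $C_0$-group $(V^h_{t,0})_{t\in\mathbb R}$. -/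

import Mathlib

open Filter Topology
open scoped ComplexOrder

noncomputable section

namespace StateFlow

/-! ### The state space -/

/-- The set of states of a unital C⋆-algebra `X`: the positive normalized elements of the dual of
`X`, the dual carrying its weak⋆ topology. -/
def stateSet (X : Type*) [CStarAlgebra X] : Set (WeakDual ℂ X) :=
  {ρ | (∀ A : X, 0 ≤ ρ (star A * A)) ∧ ρ 1 = 1}

/-- The state space `E`, with the weak⋆ topology. -/
abbrev State (X : Type*) [CStarAlgebra X] : Type _ := ↥(stateSet X)

section Compactness

variable {X : Type*} [CStarAlgebra X]

theorem norm_apply_le_of_selfAdjoint (ρ : State X) {A : X} (hA : IsSelfAdjoint A) :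
    ‖(ρ : WeakDual ℂ X) A‖ ≤ ‖A‖ := by
  let _ : PartialOrder X := CStarAlgebra.spectralOrder X
  have : StarOrderedRing X := CStarAlgebra.spectralOrderedRing X
  have key : ∀ B : X, IsSelfAdjoint B →
      0 ≤ (‖B‖ : ℂ) - (ρ : WeakDual ℂ X) B := by
    intro B hB
    have h1 : 0 ≤ algebraMap ℝ X ‖B‖ - B := sub_nonneg.mpr hB.le_algebraMap_norm_self
    obtain ⟨C, hC⟩ := CStarAlgebra.nonneg_iff_eq_star_mul_self.mp h1
    have h2 := ρ.2.1 C
    rw [← hC, map_sub, IsScalarTower.algebraMap_apply ℝ ℂ X, Algebra.algebraMap_eq_smul_one,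
      map_smul, ρ.2.2] at h2
    simpa using h2
  have h1 := key A hA
  have h2 := key (-A) hA.neg
  rw [map_neg, norm_neg] at h2
  rw [Complex.le_def] at h1 h2
  have him : ((ρ : WeakDual ℂ X) A).im = 0 := by
    have := h1.2
    simp at this
    exact this
  have hre : (ρ : WeakDual ℂ X) A = (((ρ : WeakDual ℂ X) A).re : ℂ) :=
    Complex.ext (by simp) (by simp [him])
  rw [hre, Complex.norm_real, Real.norm_eq_abs, abs_le]
  have a := h1.1
  have b := h2.1
  simp at a b
  constructor <;> linarith

theorem norm_apply_le (ρ : State X) (A : X) : ‖(ρ : WeakDual ℂ X) A‖ ≤ 2 * ‖A‖ := by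
  have h := realPart_add_I_smul_imaginaryPart A
  calc ‖(ρ : WeakDual ℂ X) A‖
      = ‖(ρ : WeakDual ℂ X) (realPart A : X) +
          Complex.I • (ρ : WeakDual ℂ X) (imaginaryPart A : X)‖ := by
        conv_lhs => rw [← h]
        rw [map_add, map_smul]
    _ ≤ ‖(ρ : WeakDual ℂ X) (realPart A : X)‖ + ‖(ρ : WeakDual ℂ X) (imaginaryPart A : X)‖ := by
        refine (norm_add_le _ _).trans ?_
        rw [norm_smul, Complex.norm_I, one_mul]
    _ ≤ ‖(realPart A : X)‖ + ‖(imaginaryPart A : X)‖ :=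
        add_le_add (norm_apply_le_of_selfAdjoint ρ (realPart A).2)
          (norm_apply_le_of_selfAdjoint ρ (imaginaryPart A).2)
    _ ≤ ‖A‖ + ‖A‖ := add_le_add (realPart.norm_le A) (imaginaryPart.norm_le A)
    _ = 2 * ‖A‖ := (two_mul _).symm

theorem isClosed_stateSet : IsClosed (stateSet X) := by
  have h : stateSet X = (⋂ A : X, {ρ : WeakDual ℂ X | 0 ≤ ρ (star A * A)}) ∩ {ρ | ρ 1 = 1} := by
    ext ρ
    simp [stateSet]
  rw [h]
  refine (isClosed_iInter fun A => ?_).inter ?_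
  · exact isClosed_le continuous_const (WeakDual.eval_continuous _)
  · exact isClosed_eq (WeakDual.eval_continuous _) continuous_const

theorem isCompact_stateSet : IsCompact (stateSet X) := by
  have hsub : stateSet X ⊆ WeakDual.toStrongDual ⁻¹' Metric.closedBall (0 : StrongDual ℂ X) 2 := by
    intro ρ hρ
    rw [Set.mem_preimage, mem_closedBall_zero_iff]
    exact ContinuousLinearMap.opNorm_le_bound _ zero_le_two fun A => norm_apply_le ⟨ρ, hρ⟩ A
  exact (WeakDual.isCompact_closedBall (0 : StrongDual ℂ X) 2).of_isClosed_subset isClosed_stateSet hsub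

instance instCompactSpaceState : CompactSpace (State X) :=
  isCompact_iff_compactSpace.mp isCompact_stateSet

end Compactness

variable {X : Type*} [CStarAlgebra X]

/-- The convex combination `(1 - l) ρ + l υ` of two states, for `l ∈ [0, 1]`. -/
def mix (ρ υ : State X) (l : unitInterval) : State X :=
  ⟨((1 - (l : ℝ) : ℝ) : ℂ) • (ρ : WeakDual ℂ X) + ((l : ℝ) : ℂ) • (υ : WeakDual ℂ X), by
    constructor
    · intro A
      have h1 : (0 : ℂ) ≤ ((1 - (l : ℝ) : ℝ) : ℂ) := by
        rw [Complex.zero_le_real]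
        linarith [l.2.2]
      have h2 : (0 : ℂ) ≤ ((l : ℝ) : ℂ) := by
        rw [Complex.zero_le_real]
        exact l.2.1
      exact add_nonneg (mul_nonneg h1 (ρ.2.1 A)) (mul_nonneg h2 (υ.2.1 A))
    · change ((1 - (l : ℝ) : ℝ) : ℂ) * (ρ : WeakDual ℂ X) 1
        + ((l : ℝ) : ℂ) * (υ : WeakDual ℂ X) 1 = 1
      rw [ρ.2.2, υ.2.2]
      push_cast
      ring⟩

/-- The function `Â ∈ C(E; ℂ)`, `Â(ρ) = ρ(A)`. -/
def hat (A : X) : C(State X, ℂ) :=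
  ⟨fun ρ => (ρ : WeakDual ℂ X) A, (WeakDual.eval_continuous A).comp continuous_subtype_val⟩

/-- For a self-adjoint set `𝓑 ⊆ X`, the algebra of polynomials, with complex coefficients, in the
functions `B̂`, `B ∈ 𝓑` (constants included), as a subalgebra of `C(E; ℂ)`. -/
def polynomials (𝓑 : Set X) : Subalgebra ℂ C(State X, ℂ) :=
  Algebra.adjoin ℂ (hat '' 𝓑)

/-- A real-valued continuous function on `E`, seen as a complex-valued one. -/
def complexify (h : C(State X, ℝ)) : C(State X, ℂ) :=
  ⟨fun ρ => (h ρ : ℂ), Complex.continuous_ofReal.comp h.continuous⟩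

/-! ### The convex weak⋆-continuous Gateaux derivative and the Poisson bracket -/

section Derivative

variable {Y : Type*} [NormedAddCommGroup Y] [NormedSpace ℝ Y]

/-- `g ∈ C(E; Y)` is affine, i.e. `g ∈ 𝓐(E; Y)`. -/
def IsAffine (g : C(State X, Y)) : Prop :=
  ∀ (l : unitInterval) (ρ υ : State X), g (mix ρ υ l) = (1 - (l : ℝ)) • g ρ + (l : ℝ) • g υ

/-- `D ∈ 𝓐(E; Y)` is the convex weak⋆-continuous Gateaux derivative `df(ρ)` of `f` at `ρ`. -/
def HasGateauxDerivAt (f : C(State X, Y)) (D : C(State X, Y)) (ρ : State X) : Prop :=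
  IsAffine D ∧ ∀ υ : State X,
    Tendsto (fun l : unitInterval => (l : ℝ)⁻¹ • (f (mix ρ υ l) - f ρ)) (𝓝[>] 0) (𝓝 (D υ))

/-- `f ∈ C¹(E; Y)`: the derivative `df(ρ)` exists at every state `ρ` and `ρ ↦ df(ρ)` is continuous
from `E` to `𝓐(E; Y)` with the supremum norm. -/
def IsContDiff (f : C(State X, Y)) : Prop :=
  ∃ df : C(State X, C(State X, Y)), ∀ ρ, HasGateauxDerivAt f (df ρ) ρ

end Derivative

open scoped Classical in
/-- `Df(ρ)`: the element of `X` such that `df(ρ)` is the function `υ ↦ υ(Df(ρ))` (it is unique,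
since states separate the elements of `X`; it exists if `f ∈ C¹(E; ℂ)`, since the affine elements of
`C(E; ℂ)` are exactly the functions `Â`, `A ∈ X`). The value is `0` if there is no such element. -/
def stateGradient (f : C(State X, ℂ)) (ρ : State X) : X :=
  if H : ∃ A : X, HasGateauxDerivAt f (hat A) ρ then H.choose else 0

/-- The Poisson bracket `{f, g}(ρ) = ρ(i [Df(ρ), Dg(ρ)])`. -/
def bracket (f g : C(State X, ℂ)) (ρ : State X) : ℂ :=
  (ρ : WeakDual ℂ X)
    (Complex.I • (stateGradient f ρ * stateGradient g ρ - stateGradient g ρ * stateGradient f ρ))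

/-- `d` is the linear operator on `C(E; ℂ)` with domain the algebra of all polynomials in the
functions `Â`, `A ∈ X`, that maps `f` to `{h, f}`. (There is at most one such `d`.) -/
def IsPoissonianDerivation (h : C(State X, ℝ)) (d : C(State X, ℂ) →ₗ.[ℂ] C(State X, ℂ)) : Prop :=
  d.domain = Subalgebra.toSubmodule (polynomials (Set.univ : Set X)) ∧
    ∀ (f : d.domain) (ρ : State X), d f ρ = bracket (complexify h) f ρ

/-! ### Quantum dynamics and the self-consistency equation -/

/-- The bounded derivation `X^ρ(A) = i [Dh(ρ), A]` of `X`. -/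
def innerDerivation (h : C(State X, ℝ)) (ρ : State X) : X →L[ℂ] X :=
  Complex.I • (ContinuousLinearMap.mul ℂ X (stateGradient (complexify h) ρ) -
    (ContinuousLinearMap.mul ℂ X).flip (stateGradient (complexify h) ρ))

/-- `T` is the evolution family `(T_{t,s}^ξ)` in the bounded operators on `X`, i.e. the solution of
`∂_t T_{t,s} = T_{t,s} ∘ X^{ξ(t)}`, `T_{s,s} = 1` (in operator norm), for a curve of states `ξ`. -/
def IsEvolution (h : C(State X, ℝ)) (ξ : ℝ → State X) (T : ℝ → ℝ → X →L[ℂ] X) : Prop :=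
  ∀ s : ℝ, T s s = ContinuousLinearMap.id ℂ X ∧
    ∀ t : ℝ, HasDerivAt (fun r => T r s) ((T t s).comp (innerDerivation h (ξ t))) t

/-- `ϖ ∈ C(ℝ²; Aut(E))` solves the self-consistency equation of the time-independent Hamiltonian
`h`: `ϖ(s,t)(ρ) = ρ ∘ T_{t,s}^ξ` with `ξ = ϖ(s,·)(ρ)`. Here `Aut(E)` is the set of
self-homeomorphisms of `E`, with the topology of uniform convergence, i.e. (`E` being compact) the
compact-open topology of `C(E; E)`. -/
def IsSelfConsistentFlow (h : C(State X, ℝ)) (ϖ : ℝ → ℝ → State X ≃ₜ State X) : Prop :=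
  Continuous (fun p : ℝ × ℝ => ((ϖ p.1 p.2 : C(State X, State X)))) ∧
    ∀ (s : ℝ) (ρ : State X), ∃ T : ℝ → ℝ → X →L[ℂ] X,
      IsEvolution h (fun t => ϖ s t ρ) T ∧
        ∀ (t : ℝ) (A : X), (ϖ s t ρ : WeakDual ℂ X) A = (ρ : WeakDual ℂ X) (T t s A)

/-- The classical evolution `V_{t,s}(f) = f ∘ ϖ(s,t)`, a ⋆-automorphism of `C(E; ℂ)`. -/
def classicalEvolution (ϖ : ℝ → ℝ → State X ≃ₜ State X) (t s : ℝ) :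
    C(State X, ℂ) ≃⋆ₐ[ℂ] C(State X, ℂ) :=
  (ϖ s t).compStarAlgEquiv' ℂ ℂ

/-! ### One-parameter groups and their generators -/

section Groups

variable {F : Type*} [NormedAddCommGroup F] [NormedSpace ℂ F]

/-- `U` is a `C₀`-group of bounded operators on `F`. -/
structure IsC0Group (U : ℝ → F →L[ℂ] F) : Prop where
  zero : U 0 = ContinuousLinearMap.id ℂ F
  add : ∀ s t, U (s + t) = (U s).comp (U t)
  continuous_apply : ∀ x, Continuous fun t => U t x

/-- The generator of `U`: its domain is the set of all `x` for which `t ↦ U t x` is differentiable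
at `0`, and it maps `x` to this derivative. -/
def generator (U : ℝ → F →L[ℂ] F) : F →ₗ.[ℂ] F where
  domain :=
    { carrier := {x | DifferentiableAt ℝ (fun t => U t x) 0}
      add_mem' := fun {x y} hx hy => by
        simpa only [Set.mem_ofPred_eq, map_add] using DifferentiableAt.fun_add hx hy
      zero_mem' := by simp
      smul_mem' := fun c x hx => by
        simpa only [Set.mem_ofPred_eq, map_smul] using DifferentiableAt.fun_const_smul hx c }
  toFun :=
    { toFun := fun x => deriv (fun t => U t (x : F)) 0
      map_add' := fun x y => by
        simpa only [Submodule.coe_add, map_add] using deriv_fun_add x.2 y.2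
      map_smul' := fun c x => by
        simpa only [Submodule.coe_smul, map_smul, RingHom.id_apply] using
          deriv_fun_const_smul c x.2 }

/-- `L` is dissipative: `‖(l - L) x‖ ≥ l ‖x‖` for all `l > 0` and all `x` in the domain of `L`. -/
def IsDissipative (L : F →ₗ.[ℂ] F) : Prop :=
  ∀ (x : L.domain) (l : ℝ), 0 < l → l * ‖(x : F)‖ ≤ ‖(l : ℂ) • (x : F) - L x‖

/-- `L` is conservative: both `L` and `-L` are dissipative. -/
def IsConservative (L : F →ₗ.[ℂ] F) : Prop :=
  IsDissipative L ∧ IsDissipative (-L)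

end Groups

/-- The one-parameter family `t ↦ V_{t,0}` of the classical evolution, as bounded operators on
`C(E; ℂ)`. -/
def classicalGroup (ϖ : ℝ → ℝ → State X ≃ₜ State X) (t : ℝ) :
    C(State X, ℂ) →L[ℂ] C(State X, ℂ) where
  toFun := classicalEvolution ϖ t 0
  map_add' := map_add _
  map_smul' := map_smul _
  cont := ContinuousMap.continuous_precomp _

end StateFlow

end

open StateFlow

noncomputable section

namespace StateFlow

variable {X : Type*} [CStarAlgebra X]

/-! ### States -/

/-! With G = Dh, the self-consistency equation says that each trajectory is an integral curve of the
field ρ ↦ ρ(i[G(ρ), ·]) on states. To solve it, write Φ_t(ρ) = ρ(u · u⋆), where u' = i u G(Φ_t(ρ))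
and u(0) = 1. Treating all initial states at once gives one ordinary differential equation in the
Banach space C(E; X) (`exists_propagator`), so that t ↦ Â ∘ Φ_t is differentiable in supremum norm.
Integral curves are unique because the field is Lipschitz for the dual norm (`IsStateCurve.unique`);
this yields the group law and the uniqueness of ϖ.

The maps V_t f = f ∘ Φ_t form a group of contractions, so its generator is closed and conservative.
By the Leibniz rule it acts on polynomials as {h, ·}; hence the Poissonian derivation is a
restriction of it, which gives (i).

For (ii), a group U with a conservative generator extending the derivation is isometric, and it
fixes 1. A unital isometry of C(E; ℂ) onto itself is a composition operator
(`exists_apply_eq_of_isometry`), so U_t f(ρ) = f(c_ρ(t)). The action of the generator on the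
functions Â shows that c_ρ is an integral curve, hence c_ρ(t) = Φ_t(ρ).

For (iii), the generator is dissipative, so it suffices that 1 - d has dense range
(`IsDissipative.le_closure_of_dense`). If h is a polynomial, then {h, ·} raises degrees by a bounded
amount, and the n-th iterate on a polynomial has norm at most K n! Rⁿ: polynomials are analytic
vectors. A functional ψ vanishing on the range of 1 - d then satisfies ψ(V_t f) = eᵗ ψ(f) for t ≥ 0,
which is incompatible with ‖V_t f‖ ≤ ‖f‖ unless ψ(f) = 0 (`IsStateFlow.dual_eq_zero`). -/

theorem im_apply_eq_zero (ρ : State X) {A : X} (hA : IsSelfAdjoint A) : (ρ.1 A).im = 0 := by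
  let _ : PartialOrder X := CStarAlgebra.spectralOrder X
  have : StarOrderedRing X := CStarAlgebra.spectralOrderedRing X
  have h1 : 0 ≤ algebraMap ℝ X ‖A‖ - A := sub_nonneg.mpr hA.le_algebraMap_norm_self
  obtain ⟨C, hC⟩ := CStarAlgebra.nonneg_iff_eq_star_mul_self.mp h1
  have h2 := ρ.2.1 C
  rw [← hC, map_sub, IsScalarTower.algebraMap_apply ℝ ℂ X, Algebra.algebraMap_eq_smul_one,
    map_smul, ρ.2.2, Complex.le_def] at h2
  simpa using h2.2

theorem apply_eq_re_add_im (ρ : State X) (A : X) :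
    ρ.1 A = ρ.1 (realPart A : X) + Complex.I * ρ.1 (imaginaryPart A : X) := by
  conv_lhs => rw [← realPart_add_I_smul_imaginaryPart A]
  rw [map_add, map_smul, smul_eq_mul]

theorem apply_star (ρ : State X) (A : X) : ρ.1 (star A) = star (ρ.1 A) := by
  have h1 := im_apply_eq_zero ρ (realPart A).2
  have h2 := im_apply_eq_zero ρ (imaginaryPart A).2
  have h3 : star A = (realPart A : X) - Complex.I • (imaginaryPart A : X) := by
    conv_lhs => rw [← realPart_add_I_smul_imaginaryPart A]
    rw [star_add, star_smul, (realPart A).2.star_eq, (imaginaryPart A).2.star_eq]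
    simp [sub_eq_add_neg]
  rw [apply_eq_re_add_im ρ A, h3, map_sub, map_smul]
  apply Complex.ext <;> simp [h1, h2]

/-- Weak⋆ continuity in the state suffices, since all states are Lipschitz in A with the same
constant 2. -/
theorem continuous_apply_apply : Continuous fun p : State X × X => p.1.1 p.2 := by
  refine continuous_prod_of_continuous_lipschitzWith' _ 2 (fun ρ => ?_) fun A => (hat A).continuous
  refine LipschitzWith.of_dist_le_mul fun A B => ?_
  rw [dist_eq_norm, dist_eq_norm, ← map_sub]
  exact norm_apply_le ρ _

theorem continuous_state_iff {T : Type*} [TopologicalSpace T] {f : T → State X} :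
    Continuous f ↔ ∀ A : X, Continuous fun t => (f t).1 A := by
  rw [continuous_induced_rng]
  exact ⟨fun h A => (WeakDual.eval_continuous A).comp h,
    fun h => WeakDual.continuous_of_continuous_eval h⟩

theorem state_ext {ρ υ : State X} (h : ∀ A, ρ.1 A = υ.1 A) : ρ = υ :=
  Subtype.ext (DFunLike.ext _ _ h)

/-- The test elements A + i l satisfy ‖A + i l‖² ≤ ‖A‖² + l², while ψ(A + i l) has imaginary part Im
ψ(A) + l. Hence 2 l Im ψ(A) ≤ ‖A‖² for every real l. -/
theorem im_eq_zero_of_norm_le (ψ : X →L[ℂ] ℂ) (h : ∀ A, ‖ψ A‖ ≤ ‖A‖) (h1 : ψ 1 = 1) {A : X}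
    (hA : IsSelfAdjoint A) : (ψ A).im = 0 := by
  have key : ∀ l : ℝ, 2 * l * (ψ A).im ≤ ‖A‖ ^ 2 := by
    intro l
    rcases subsingleton_or_nontrivial X with hX | hX
    · rw [Subsingleton.elim A 0]; simp
    have e1 := h (A + (Complex.I * l) • (1 : X))
    have e2 : ‖A + (Complex.I * l) • (1 : X)‖ ^ 2 ≤ ‖A‖ ^ 2 + l ^ 2 := by
      rw [sq, ← CStarRing.norm_star_mul_self, star_add, star_smul, hA.star_eq, star_one]
      have : (A + star (Complex.I * (l : ℂ)) • (1 : X)) * (A + (Complex.I * l) • (1 : X))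
          = A * A + ((l ^ 2 : ℝ) : ℂ) • (1 : X) := by
        simp only [add_mul, mul_add, mul_smul_comm, smul_mul_assoc, mul_one, one_mul,
          star_mul', RCLike.star_def, Complex.conj_I, Complex.conj_ofReal]
        have : -Complex.I * (l : ℂ) * (Complex.I * l) = ((l ^ 2 : ℝ) : ℂ) := by
          push_cast
          linear_combination -((l : ℂ) ^ 2) * Complex.I_mul_I
        rw [smul_add, smul_smul, mul_comm (Complex.I * (l : ℂ)), this]
        module
      rw [this]
      refine (norm_add_le _ _).trans (add_le_add ?_ ?_)
      · rw [sq]; exact norm_mul_le _ _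
      · rw [norm_smul, norm_one, mul_one, Complex.norm_real, Real.norm_of_nonneg (sq_nonneg l)]
    rw [map_add, map_smul, h1] at e1
    have e3 : ((ψ A).im + l) ^ 2 ≤ ‖ψ A + (Complex.I * (l : ℂ)) • (1 : ℂ)‖ ^ 2 := by
      rw [← sq_abs]
      refine pow_le_pow_left₀ (abs_nonneg _) ?_ 2
      refine le_trans (le_of_eq ?_) (Complex.abs_im_le_norm _)
      simp
    have e4 := pow_le_pow_left₀ (norm_nonneg _) e1 2
    nlinarith [sq_nonneg (ψ A).im]
  by_contra hne
  -- This l makes the left-hand side equal to ‖A‖² + 1.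
  have := key ((‖A‖ ^ 2 + 1) / (2 * (ψ A).im))
  have e : 2 * ((‖A‖ ^ 2 + 1) / (2 * (ψ A).im)) * (ψ A).im = ‖A‖ ^ 2 + 1 := by
    field_simp
  linarith

/-- A unital contractive functional is a state. -/
theorem star_mul_self_nonneg_of_norm_le (ψ : X →L[ℂ] ℂ) (h : ∀ A, ‖ψ A‖ ≤ ‖A‖) (h1 : ψ 1 = 1)
    (A : X) : 0 ≤ ψ (star A * A) := by
  let _ : PartialOrder X := CStarAlgebra.spectralOrder X
  have : StarOrderedRing X := CStarAlgebra.spectralOrderedRing X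
  rcases subsingleton_or_nontrivial X with hX | hX
  · rw [Subsingleton.elim (star A * A) 0, map_zero]
  have hsa : IsSelfAdjoint (star A * A) := IsSelfAdjoint.star_mul_self A
  have him := im_eq_zero_of_norm_le ψ h h1 hsa
  set a := star A * A with ha
  have ha0 : 0 ≤ a := star_mul_self_nonneg A
  -- From 0 ≤ ‖a‖ - a ≤ ‖a‖. Contractivity then gives |‖a‖ - ψ(a)| ≤ ‖a‖, which forces Re ψ(a) ≥ 0.
  have e1 : ‖algebraMap ℝ X ‖a‖ - a‖ ≤ ‖a‖ := by
    have e2 : ‖algebraMap ℝ X ‖a‖ - a‖ ≤ ‖algebraMap ℝ X ‖a‖‖ :=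
      CStarAlgebra.norm_le_norm_of_nonneg_of_le (sub_nonneg.mpr hsa.le_algebraMap_norm_self)
        (sub_le_self _ ha0)
    simpa using e2
  have e3 := (h _).trans e1
  rw [map_sub, IsScalarTower.algebraMap_apply ℝ ℂ X, Algebra.algebraMap_eq_smul_one, map_smul,
    h1] at e3
  have e4 := (Complex.abs_re_le_norm _).trans e3
  rw [abs_le] at e4
  rw [Complex.le_def]
  refine ⟨?_, by simp [him]⟩
  have := e4.2
  simp at this ⊢
  exact this

/-- The state given by a unital contractive functional. -/
def stateOfContractive (ψ : X →L[ℂ] ℂ) (h : ∀ A, ‖ψ A‖ ≤ ‖A‖) (h1 : ψ 1 = 1) : State X :=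
  ⟨StrongDual.toWeakDual ψ, star_mul_self_nonneg_of_norm_le ψ h h1, h1⟩

/-- The spectrum of a self-adjoint A contains a point z of modulus ‖A‖. It is the value at A of a
character of the C⋆-algebra generated by A, and a norm-preserving Hahn-Banach extension of this
character is unital and contractive, hence a state. -/
theorem exists_state_apply_ne_zero {A : X} (hA : IsSelfAdjoint A) (h0 : A ≠ 0) :
    ∃ ρ : State X, ρ.1 A ≠ 0 := by
  have : Nontrivial X := ⟨A, 0, h0⟩
  obtain ⟨z, hz, hzn⟩ := spectrum.exists_nnnorm_eq_spectralRadius A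
  rw [hA.spectralRadius_eq_nnnorm] at hzn
  have hz0 : z ≠ 0 := by
    rintro rfl
    simp at hzn
    exact h0 (nnnorm_eq_zero.mp hzn.symm)
  have hn : IsStarNormal A := hA.isStarNormal
  obtain ⟨χ, hχ⟩ := (StarAlgebra.elemental.bijective_characterSpaceToSpectrum A).2 ⟨z, hz⟩
  have hχ' : χ ⟨A, StarAlgebra.elemental.self_mem ℂ A⟩ = z := congrArg Subtype.val hχ
  let χ₀ : StrongDual ℂ (Subalgebra.toSubmodule (StarAlgebra.elemental ℂ A).toSubalgebra) :=
    WeakDual.toStrongDual χ.1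
  obtain ⟨ψ, hψ, hψn⟩ := exists_extension_norm_eq
    (Subalgebra.toSubmodule (StarAlgebra.elemental ℂ A).toSubalgebra) χ₀
  have hle : ‖χ₀‖ ≤ 1 :=
    (WeakDual.CharacterSpace.norm_le_norm_one χ).trans norm_one.le
  have hc : ∀ B, ‖ψ B‖ ≤ ‖B‖ := fun B => by
    refine (ψ.le_opNorm B).trans ?_
    rw [hψn]
    exact mul_le_of_le_one_left (norm_nonneg _) hle
  have h1 : ψ 1 = 1 := by
    have := hψ ⟨1, (StarAlgebra.elemental ℂ A).one_mem⟩
    exact this.trans (map_one χ)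
  refine ⟨stateOfContractive ψ hc h1, ?_⟩
  have h2 : ψ A = z := (hψ ⟨A, StarAlgebra.elemental.self_mem ℂ A⟩).trans hχ'
  change ψ A ≠ 0
  rwa [h2]

/-- States separate the elements of a C⋆-algebra. -/
theorem eq_of_forall_state {A B : X} (h : ∀ ρ : State X, ρ.1 A = ρ.1 B) : A = B := by
  have key : ∀ C : X, (∀ ρ : State X, ρ.1 C = 0) → C = 0 := by
    intro C hC
    have h1 : (realPart C : X) = 0 ∧ (imaginaryPart C : X) = 0 := by
      constructor <;> by_contra hne
      · obtain ⟨ρ, hρ⟩ := exists_state_apply_ne_zero (realPart C).2 hne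
        have := congrArg Complex.re ((apply_eq_re_add_im ρ C).symm.trans (hC ρ))
        have e1 := im_apply_eq_zero ρ (realPart C).2
        have e2 := im_apply_eq_zero ρ (imaginaryPart C).2
        simp [e2] at this
        exact hρ (Complex.ext this e1)
      · obtain ⟨ρ, hρ⟩ := exists_state_apply_ne_zero (imaginaryPart C).2 hne
        have := congrArg Complex.im ((apply_eq_re_add_im ρ C).symm.trans (hC ρ))
        have e1 := im_apply_eq_zero ρ (realPart C).2
        have e2 := im_apply_eq_zero ρ (imaginaryPart C).2
        simp [e1] at this
        exact hρ (Complex.ext this e2)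
    rw [← realPart_add_I_smul_imaginaryPart C, h1.1, h1.2, smul_zero, add_zero]
  refine sub_eq_zero.mp (key _ fun ρ => ?_)
  rw [map_sub, h ρ, sub_self]

theorem isSelfAdjoint_of_forall_im {A : X} (h : ∀ ρ : State X, (ρ.1 A).im = 0) :
    IsSelfAdjoint A := by
  refine eq_of_forall_state fun ρ => ?_
  rw [apply_star]
  exact Complex.ext (by simp) (by simp [h ρ])

/-! ### Gradients -/

theorem isAffine_hat (A : X) : IsAffine (hat A) := by
  intro l ρ υ
  change ((1 - (l : ℝ) : ℝ) : ℂ) * ρ.1 A + ((l : ℝ) : ℂ) * υ.1 A = _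
  simp only [Complex.real_smul]
  rfl

theorem nhdsGT_unitInterval_neBot : (𝓝[>] (0 : unitInterval)).NeBot :=
  nhdsGT_neBot_of_exists_gt ⟨1, zero_lt_one⟩

theorem HasGateauxDerivAt.hat_unique {f : C(State X, ℂ)} {A B : X} {ρ : State X}
    (hA : HasGateauxDerivAt f (hat A) ρ) (hB : HasGateauxDerivAt f (hat B) ρ) : A = B :=
  have := nhdsGT_unitInterval_neBot
  eq_of_forall_state fun υ => tendsto_nhds_unique (hA.2 υ) (hB.2 υ)

theorem HasGateauxDerivAt.stateGradient_eq {f : C(State X, ℂ)} {A : X} {ρ : State X}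
    (hA : HasGateauxDerivAt f (hat A) ρ) : stateGradient f ρ = A := by
  have H : ∃ A : X, HasGateauxDerivAt f (hat A) ρ := ⟨A, hA⟩
  rw [stateGradient, dif_pos H]
  exact H.choose_spec.hat_unique hA

/-- The gradient of a real function is self-adjoint, since its derivative takes real values. -/
theorem isSelfAdjoint_stateGradient (h : C(State X, ℝ)) (ρ : State X) :
    IsSelfAdjoint (stateGradient (complexify h) ρ) := by
  by_cases H : ∃ A : X, HasGateauxDerivAt (complexify h) (hat A) ρ
  · rw [stateGradient, dif_pos H]
    have := nhdsGT_unitInterval_neBot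
    refine isSelfAdjoint_of_forall_im fun υ => ?_
    have h1 := (Complex.continuous_im.tendsto _).comp (H.choose_spec.2 υ)
    refine tendsto_nhds_unique h1 ?_
    refine tendsto_const_nhds.congr fun l => ?_
    simp [complexify]
  · rw [stateGradient, dif_neg H]
    exact IsSelfAdjoint.zero X

/-- The regularity of the gradient of a Hamiltonian that the construction of its flow uses. -/
structure IsLipschitzField (G : State X → X) (D M : ℝ) : Prop where
  isSelfAdjoint : ∀ ρ, IsSelfAdjoint (G ρ)
  continuous : Continuous G
  norm_le : ∀ ρ, ‖G ρ‖ ≤ M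
  norm_sub_le : ∀ (ρ υ : State X) (δ : ℝ), 0 ≤ δ →
    (∀ A, ‖ρ.1 A - υ.1 A‖ ≤ δ * ‖A‖) → ‖G ρ - G υ‖ ≤ D * δ
  bound_nonneg : 0 ≤ M
  const_nonneg : 0 ≤ D

/-- Finite dimension makes the unit sphere of 𝔅 compact, so restricting states to it is continuous
from the weak⋆ topology to the supremum norm. The gradient is therefore weak⋆-continuous, and
bounded because E is compact. -/
theorem exists_isLipschitzField (𝔅 : Submodule ℝ (selfAdjoint X)) [FiniteDimensional ℝ 𝔅]
    (h : C(State X, ℝ)) (D₀ : ℝ) (hD₀ : 0 < D₀)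
    (hLip : ∀ ρ υ : State X,
      ‖stateGradient (complexify h) ρ - stateGradient (complexify h) υ‖ ≤
        D₀ * sSup {r : ℝ | ∃ B ∈ 𝔅, ‖B‖ = 1 ∧
          r = ‖(ρ : WeakDual ℂ X) (B : X) - (υ : WeakDual ℂ X) (B : X)‖}) :
    ∃ M, IsLipschitzField (stateGradient (complexify h)) D₀ M := by
  have hlip : ∀ (ρ υ : State X) (δ : ℝ), 0 ≤ δ →
      (∀ B ∈ 𝔅, ‖B‖ = 1 → ‖ρ.1 (B : X) - υ.1 (B : X)‖ ≤ δ) →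
      ‖stateGradient (complexify h) ρ - stateGradient (complexify h) υ‖ ≤ D₀ * δ := by
    intro ρ υ δ hδ H
    refine (hLip ρ υ).trans (mul_le_mul_of_nonneg_left ?_ hD₀.le)
    -- If 𝔅 = 0 the set is empty and its supremum is 0 by convention; this is where 0 ≤ δ matters.
    refine Real.sSup_le ?_ hδ
    rintro r ⟨B, hB, hB1, rfl⟩
    exact H B hB hB1
  have hcont : Continuous (stateGradient (complexify h)) := by
    let K := Metric.sphere (0 : 𝔅) 1
    have : CompactSpace K := isCompact_iff_compactSpace.mp (isCompact_sphere _ _)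
    have hr : Continuous fun p : State X × K => p.1.1 ((p.2.1 : selfAdjoint X) : X) := by
      have : Continuous fun p : State X × K => (p.1, ((p.2.1 : selfAdjoint X) : X)) := by
        fun_prop
      exact continuous_apply_apply.comp this
    let r : C(State X, C(K, ℂ)) := ContinuousMap.curry ⟨_, hr⟩
    have hle : ∀ ρ υ, ‖stateGradient (complexify h) ρ - stateGradient (complexify h) υ‖
        ≤ D₀ * ‖r ρ - r υ‖ := by
      intro ρ υ
      refine hlip ρ υ _ (norm_nonneg _) fun B hB hB1 => ?_
      have hB' : (⟨B, hB⟩ : 𝔅) ∈ K := by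
        rw [mem_sphere_zero_iff_norm]; exact hB1
      exact (r ρ - r υ).norm_coe_le_norm ⟨⟨B, hB⟩, hB'⟩
    refine continuous_iff_continuousAt.mpr fun ρ => ?_
    rw [ContinuousAt, tendsto_iff_norm_sub_tendsto_zero]
    refine squeeze_zero (fun _ => norm_nonneg _) (fun υ => hle υ ρ) ?_
    have h1 : Tendsto (fun υ => ‖r υ - r ρ‖) (𝓝 ρ) (𝓝 0) :=
      tendsto_iff_norm_sub_tendsto_zero.mp (r.continuous.tendsto ρ)
    simpa using h1.const_mul D₀
  let Gc : C(State X, X) := ⟨_, hcont⟩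
  refine ⟨‖Gc‖, isSelfAdjoint_stateGradient h, hcont, fun ρ => Gc.norm_coe_le_norm ρ, ?_,
    norm_nonneg _, hD₀.le⟩
  intro ρ υ δ hδ H
  refine hlip ρ υ δ hδ fun B _ hB1 => ?_
  refine (H _).trans (le_of_eq ?_)
  have : ‖(B : X)‖ = 1 := hB1
  rw [this, mul_one]

/-! ### Global solutions of differential equations -/

section ODE

variable {Z : Type*} [NormedAddCommGroup Z] [NormedSpace ℝ Z]

/-- The radial retraction of a normed space onto its closed unit ball. -/
def clip (x : Z) : Z := (max 1 ‖x‖)⁻¹ • x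

theorem norm_clip_le (x : Z) : ‖clip x‖ ≤ 1 := by
  have h : (0 : ℝ) < max 1 ‖x‖ := lt_of_lt_of_le one_pos (le_max_left _ _)
  rw [clip, norm_smul, norm_inv, Real.norm_of_nonneg h.le, inv_mul_le_iff₀ h, mul_one]
  exact le_max_right _ _

theorem clip_of_norm_le {x : Z} (h : ‖x‖ ≤ 1) : clip x = x := by
  rw [clip, max_eq_left h, inv_one, one_smul]

theorem norm_clip_sub_le (x y : Z) : ‖clip x - clip y‖ ≤ 2 * ‖x - y‖ := by
  set a := max 1 ‖x‖ with ha
  set b := max 1 ‖y‖ with hb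
  have ha1 : 1 ≤ a := le_max_left _ _
  have hb1 : 1 ≤ b := le_max_left _ _
  have hyb : ‖y‖ ≤ b := le_max_right _ _
  have hab : |b - a| ≤ ‖x - y‖ := by
    rw [abs_sub_comm]
    have h1 := abs_max_sub_max_le_max 1 ‖x‖ 1 ‖y‖
    rw [sub_self, abs_zero, max_eq_right (abs_nonneg (‖x‖ - ‖y‖))] at h1
    exact h1.trans (abs_norm_sub_norm_le x y)
  have e : clip x - clip y = a⁻¹ • (x - y) + (a⁻¹ * (b - a) * b⁻¹) • y := by
    have : a⁻¹ * (b - a) * b⁻¹ = a⁻¹ - b⁻¹ := by field_simp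
    rw [this, clip, clip, smul_sub, sub_smul]
    abel
  have ha' : a⁻¹ ≤ 1 := inv_le_one_of_one_le₀ ha1
  have ha0 : 0 ≤ a⁻¹ := by positivity
  rw [e, two_mul]
  refine (norm_add_le _ _).trans (add_le_add ?_ ?_)
  · rw [norm_smul, Real.norm_of_nonneg ha0]
    exact mul_le_of_le_one_left (norm_nonneg _) ha'
  · rw [norm_smul, norm_mul, norm_mul, Real.norm_of_nonneg ha0, Real.norm_eq_abs,
      Real.norm_of_nonneg (by positivity : 0 ≤ b⁻¹), mul_assoc]
    have h3 : b⁻¹ * ‖y‖ ≤ 1 := by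
      rw [inv_mul_le_iff₀ (by positivity), mul_one]; exact hyb
    calc a⁻¹ * |b - a| * (b⁻¹ * ‖y‖) ≤ 1 * |b - a| * 1 := by gcongr
      _ ≤ ‖x - y‖ := by simpa using hab

theorem continuous_clip : Continuous (clip : Z → Z) := by
  have : LipschitzWith 2 (clip : Z → Z) := LipschitzWith.of_dist_le_mul fun x y => by
    rw [dist_eq_norm, dist_eq_norm]; exact norm_clip_sub_le x y
  exact this.continuous

variable [CompleteSpace Z]

/-- On [-(n+1), n+1] a solution cannot leave the ball of radius L(n+1), so Picard-Lindelöf applies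
on the whole interval; uniqueness glues these solutions. -/
theorem exists_global_solution (F : Z → Z) (K L : NNReal) (hK : LipschitzWith K F)
    (hL : ∀ x, ‖F x‖ ≤ L) (x₀ : Z) : ∃ u : ℝ → Z, u 0 = x₀ ∧ ∀ t, HasDerivAt u (F (u t)) t := by
  have step : ∀ n : ℕ, ∃ α : ℝ → Z, α 0 = x₀ ∧
      ∀ t ∈ Set.Ioo (-((n : ℝ) + 1)) ((n : ℝ) + 1), HasDerivAt α (F (α t)) t := by
    intro n
    have hn : (0 : ℝ) ≤ (n : ℝ) + 1 := by positivity
    have hP : IsPicardLindelof (fun _ => F) (tmin := -((n : ℝ) + 1)) (tmax := (n : ℝ) + 1)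
        ⟨0, neg_nonpos.mpr hn, hn⟩ x₀ (L * ((n : NNReal) + 1)) 0 L K := by
      refine IsPicardLindelof.of_time_independent (fun x _ => hL x) hK.lipschitzOnWith ?_
      simp
    obtain ⟨α, h0, hα⟩ := hP.exists_eq_forall_mem_Icc_hasDerivWithinAt₀
    exact ⟨α, h0, fun t ht => (hα t (Set.Ioo_subset_Icc_self ht)).hasDerivAt
      (Icc_mem_nhds ht.1 ht.2)⟩
  choose α h0 hα using step
  have huniq : ∀ n m : ℕ, n ≤ m → ∀ t : ℝ, |t| < (n : ℝ) + 1 → α n t = α m t := by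
    intro n m hnm t ht
    have hsub : Set.Ioo (-((n : ℝ) + 1)) ((n : ℝ) + 1) ⊆
        Set.Ioo (-((m : ℝ) + 1)) ((m : ℝ) + 1) := by
      have : (n : ℝ) ≤ m := by exact_mod_cast hnm
      apply Set.Ioo_subset_Ioo <;> linarith
    have hn : (0 : ℝ) < (n : ℝ) + 1 := by positivity
    refine ODE_solution_unique_of_mem_Ioo (v := fun _ => F) (s := fun _ => Set.univ) (t₀ := 0)
      (fun _ _ => hK.lipschitzOnWith) ⟨by linarith, hn⟩ (fun t ht => ⟨hα n t ht, trivial⟩)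
      (fun t ht => ⟨hα m t (hsub ht), trivial⟩) ?_ (abs_lt.mp ht)
    rw [h0, h0]
  -- Radius n + 1 instead of n puts every s with |s| ≤ n in the open interval, so index ⌈|s|⌉ is
  -- admissible at s.
  have hu : ∀ (N : ℕ) (s : ℝ), |s| ≤ N → α ⌈|s|⌉₊ s = α N s := fun N s hs =>
    huniq _ _ (Nat.ceil_le.mpr hs) s (lt_of_le_of_lt (Nat.le_ceil _) (lt_add_one _))
  refine ⟨fun t => α ⌈|t|⌉₊ t, by simp [h0], fun t => ?_⟩
  obtain ⟨N, hN⟩ := exists_nat_gt |t|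
  have hev : (fun t : ℝ => α ⌈|t|⌉₊ t) =ᶠ[𝓝 t] α N := by
    have : ∀ᶠ s : ℝ in 𝓝 t, |s| < (N : ℝ) := (continuous_abs.tendsto t).eventually_lt_const hN
    exact this.mono fun s hs => hu N s hs.le
  have hd := hα N t (abs_lt.mp (hN.trans (lt_add_one _)))
  rw [← hu N t hN.le] at hd
  exact hd.congr_of_eventuallyEq hev

/-- Picard-Lindelöf with a compact space of parameters. -/
theorem exists_global_solution_of_compact {E : Type*} [TopologicalSpace E] [CompactSpace E]
    (f : E × Z → Z) (hf : Continuous f) (K L : NNReal) (hL : ∀ p, ‖f p‖ ≤ L)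
    (hK : ∀ ρ x y, ‖f (ρ, x) - f (ρ, y)‖ ≤ K * ‖x - y‖) (x₀ : C(E, Z)) :
    ∃ u : ℝ → C(E, Z), u 0 = x₀ ∧
      ∀ t, HasDerivAt u ⟨fun ρ => f (ρ, u t ρ), by fun_prop⟩ t := by
  -- The superposition operator on C(E, Z) inherits the bound and the Lipschitz constant of f.
  let F : C(E, Z) → C(E, Z) := fun u => ⟨fun ρ => f (ρ, u ρ), by fun_prop⟩
  refine exists_global_solution F K L ?_ ?_ x₀
  · refine LipschitzWith.of_dist_le_mul fun u v => ?_
    rw [dist_eq_norm, dist_eq_norm, ContinuousMap.norm_le _ (by positivity)]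
    intro ρ
    refine (hK ρ (u ρ) (v ρ)).trans ?_
    exact mul_le_mul_of_nonneg_left ((u - v).norm_coe_le_norm ρ) K.2
  · intro u
    rw [ContinuousMap.norm_le _ L.coe_nonneg]
    exact fun ρ => hL _

end ODE

/-! ### The propagator -/

/-- The map `A ↦ w A w⋆`. -/
def conjugation (w : X) : X →L[ℂ] X := ContinuousLinearMap.mulLeftRight ℂ X w (star w)

@[simp] theorem conjugation_apply (w A : X) : conjugation w A = w * A * star w := rfl

/-- The derivation `A ↦ i [g, A]`. -/
def commutator (g : X) : X →L[ℂ] X :=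
  Complex.I • (ContinuousLinearMap.mul ℂ X g - (ContinuousLinearMap.mul ℂ X).flip g)

theorem commutator_apply (g A : X) : commutator g A = Complex.I • (g * A - A * g) := rfl

theorem norm_commutator_le (g A : X) : ‖commutator g A‖ ≤ 2 * ‖g‖ * ‖A‖ := by
  rw [commutator_apply, norm_smul, Complex.norm_I, one_mul]
  refine (norm_sub_le _ _).trans ?_
  nlinarith [norm_mul_le g A, norm_mul_le A g]

theorem continuous_clip_mul_star (A : X) : Continuous fun w : X => clip w * A * star (clip w) := by
  have := continuous_clip (Z := X)
  fun_prop

/-- The state `A ↦ ρ(w A w⋆) + (1 - ρ(w w⋆)) ρ(A)`, where `w` has first been retracted to the unit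
ball. -/
def transport (ρ : State X) (w : X) : State X :=
  ⟨StrongDual.toWeakDual ((WeakDual.toStrongDual ρ.1).comp (conjugation (clip w)) +
      (1 - ρ.1 (clip w * star (clip w))) • WeakDual.toStrongDual ρ.1), by
    constructor
    · intro A
      refine add_nonneg ?_ (mul_nonneg ?_ (ρ.2.1 A))
      · have h := ρ.2.1 (A * star (clip w))
        rw [star_mul, star_star] at h
        change 0 ≤ ρ.1 (clip w * (star A * A) * star (clip w))
        simpa only [mul_assoc] using h
      · have hsa : IsSelfAdjoint (clip w * star (clip w)) := IsSelfAdjoint.mul_star_self _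
        have h1 := norm_apply_le_of_selfAdjoint ρ hsa
        rw [CStarRing.norm_self_mul_star] at h1
        have h2 := (Complex.abs_re_le_norm _).trans h1
        have h3 := im_apply_eq_zero ρ hsa
        have h4 : ‖clip w‖ * ‖clip w‖ ≤ 1 := by
          nlinarith [norm_clip_le w, norm_nonneg (clip w)]
        rw [Complex.le_def]
        refine ⟨?_, by simp [h3]⟩
        have := le_of_abs_le h2
        simp only [Complex.zero_re, Complex.sub_re, Complex.one_re]
        linarith
    · change ρ.1 (clip w * 1 * star (clip w)) +
        (1 - ρ.1 (clip w * star (clip w))) * ρ.1 1 = 1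
      rw [ρ.2.2, mul_one]
      ring⟩

theorem transport_apply (ρ : State X) (w A : X) : (transport ρ w).1 A =
    ρ.1 (clip w * A * star (clip w)) + (1 - ρ.1 (clip w * star (clip w))) * ρ.1 A := rfl

theorem norm_le_one_of_mul_star {w : X} (h : w * star w = 1) : ‖w‖ ≤ 1 := by
  rcases subsingleton_or_nontrivial X with hX | hX
  · rw [Subsingleton.elim w 0, norm_zero]; exact zero_le_one
  have := CStarRing.norm_self_mul_star (x := w)
  rw [h, norm_one] at this
  nlinarith [norm_nonneg w]

theorem transport_apply_of_mul_star (ρ : State X) {w : X} (h : w * star w = 1) (A : X) :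
    (transport ρ w).1 A = ρ.1 (w * A * star w) := by
  rw [transport_apply, clip_of_norm_le (norm_le_one_of_mul_star h), h, ρ.2.2]
  ring

theorem continuous_transport : Continuous fun p : State X × X => transport p.1 p.2 := by
  refine continuous_state_iff.mpr fun A => ?_
  have key : ∀ B : X, Continuous fun p : State X × X =>
      p.1.1 (clip p.2 * B * star (clip p.2)) := fun B =>
    continuous_apply_apply.comp
      (continuous_fst.prodMk ((continuous_clip_mul_star B).comp continuous_snd))
  have k1 := key 1
  simp only [mul_one] at k1
  exact (key A).add ((continuous_const.sub k1).mul ((hat A).continuous.comp continuous_fst))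

theorem norm_conj_sub_le {v v' : X} (hv : ‖v‖ ≤ 1) (hv' : ‖v'‖ ≤ 1) (A : X) :
    ‖v * A * star v - v' * A * star v'‖ ≤ 2 * ‖v - v'‖ * ‖A‖ := by
  have e : v * A * star v - v' * A * star v' =
      (v - v') * A * star v + v' * A * star (v - v') := by
    rw [star_sub]; noncomm_ring
  rw [e]
  have h1 : ‖(v - v') * A * star v‖ ≤ ‖v - v'‖ * ‖A‖ * 1 := by
    refine (norm_mul_le _ _).trans ?_
    rw [norm_star]
    exact mul_le_mul (norm_mul_le _ _) hv (norm_nonneg _) (by positivity)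
  have h2 : ‖v' * A * star (v - v')‖ ≤ 1 * ‖A‖ * ‖v - v'‖ := by
    refine (norm_mul_le _ _).trans ?_
    rw [norm_star]
    refine mul_le_mul_of_nonneg_right ((norm_mul_le _ _).trans ?_) (norm_nonneg _)
    exact mul_le_mul_of_nonneg_right hv' (norm_nonneg _)
  refine (norm_add_le _ _).trans ?_
  linarith

/-- The conjugation contributes 8 = 2 · 2 · 2 (state, conjugation, retraction), the correction term
16 = 4 · 2 · 2. -/
theorem norm_transport_sub_le (ρ : State X) (w w' A : X) :
    ‖(transport ρ w).1 A - (transport ρ w').1 A‖ ≤ 24 * ‖w - w'‖ * ‖A‖ := by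
  have e : (transport ρ w).1 A - (transport ρ w').1 A =
      ρ.1 (clip w * A * star (clip w) - clip w' * A * star (clip w')) -
      ρ.1 (clip w * 1 * star (clip w) - clip w' * 1 * star (clip w')) * ρ.1 A := by
    rw [transport_apply, transport_apply, map_sub, map_sub, mul_one, mul_one]
    ring
  have h0 := norm_clip_sub_le w w'
  have h1 := (norm_apply_le ρ _).trans (mul_le_mul_of_nonneg_left
    (norm_conj_sub_le (norm_clip_le w) (norm_clip_le w') A) zero_le_two)
  have h2 : ‖ρ.1 (clip w * 1 * star (clip w) - clip w' * 1 * star (clip w'))‖ ≤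
      4 * ‖clip w - clip w'‖ := by
    have e2 : clip w * 1 * star (clip w) - clip w' * 1 * star (clip w') =
        clip w * star (clip w) - clip w' * star (clip w') := by rw [mul_one, mul_one]
    rw [e2]
    have hsa : IsSelfAdjoint (clip w * star (clip w) - clip w' * star (clip w')) :=
      (IsSelfAdjoint.mul_star_self _).sub (IsSelfAdjoint.mul_star_self _)
    refine (norm_apply_le_of_selfAdjoint ρ hsa).trans ?_
    have e3 : clip w * star (clip w) - clip w' * star (clip w') =
        (clip w - clip w') * star (clip w) + clip w' * star (clip w - clip w') := by
      rw [star_sub]; noncomm_ring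
    rw [e3]
    refine (norm_add_le _ _).trans ?_
    have a1 := norm_mul_le (clip w - clip w') (star (clip w))
    have a2 := norm_mul_le (clip w') (star (clip w - clip w'))
    rw [norm_star] at a1 a2
    nlinarith [norm_clip_le w, norm_clip_le w', norm_nonneg (clip w - clip w')]
  have h3 := norm_apply_le ρ A
  rw [e]
  refine (norm_sub_le _ _).trans ?_
  rw [norm_mul]
  have h4 : ‖ρ.1 (clip w * 1 * star (clip w) - clip w' * 1 * star (clip w'))‖ * ‖ρ.1 A‖ ≤
      4 * ‖clip w - clip w'‖ * (2 * ‖A‖) :=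
    mul_le_mul h2 h3 (norm_nonneg _) (by positivity)
  nlinarith [mul_le_mul_of_nonneg_right h0 (norm_nonneg A)]

/-- Since `clip (u t)` is a real multiple of `u t` and `g t` is self-adjoint, the two terms of the
derivative of u u⋆ cancel. -/
theorem mul_star_eq_one_of_hasDerivAt {u g : ℝ → X} (hg : ∀ t, IsSelfAdjoint (g t))
    (hu : ∀ t, HasDerivAt u (Complex.I • (clip (u t) * g t)) t) (h0 : u 0 = 1) (t : ℝ) :
    u t * star (u t) = 1 := by
  have hd : ∀ t, HasDerivAt (fun t => u t * star (u t)) 0 t := by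
    intro t
    have h : HasDerivAt (fun t => u t * star (u t)) _ t := (hu t).mul (hu t).star
    convert h using 1
    rw [star_smul, star_mul, (hg t).star_eq, clip, star_smul]
    simp only [smul_mul_assoc, mul_smul_comm, star_trivial, RCLike.star_def, Complex.conj_I,
      neg_smul, mul_assoc]
    simp
  have hc := is_const_of_deriv_eq_zero (fun t => (hd t).differentiableAt)
    (fun t => (hd t).deriv) t 0
  simpa [h0] using hc

/-- The propagator `U` of the self-consistency equation, all initial states at a time, and the flow
`Φ` that it defines. -/
theorem exists_propagator {G : State X → X} {D M : ℝ} (hG : IsLipschitzField G D M) :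
    ∃ (U : ℝ → C(State X, X)) (Φ : ℝ → C(State X, State X)), U 0 = 1 ∧
      (∀ t ρ, U t ρ * star (U t ρ) = 1) ∧
      (∀ t ρ A, (Φ t ρ).1 A = ρ.1 (U t ρ * A * star (U t ρ))) ∧
      Continuous Φ ∧
      ∀ t, HasDerivAt U (Complex.I • (U t * (ContinuousMap.mk G hG.continuous).comp (Φ t))) t := by
  -- The retraction and the correction term in `transport` extend the field to all of X, with bound
  -- M and Lipschitz constant 2M + 24D. Along solutions starting at 1 one has u u⋆ = 1, and the
  -- field is i u G(ρ(u · u⋆)).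
  let f : State X × X → X := fun p => Complex.I • (clip p.2 * G (transport p.1 p.2))
  have hM := hG.bound_nonneg
  have hD := hG.const_nonneg
  have hf : Continuous f := by
    have h1 : Continuous fun p : State X × X => G (transport p.1 p.2) :=
      hG.continuous.comp continuous_transport
    have h2 : Continuous fun p : State X × X => clip p.2 := continuous_clip.comp continuous_snd
    exact (h2.mul h1).const_smul _
  obtain ⟨U, hU0, hU⟩ := exists_global_solution_of_compact f hf
    ⟨2 * M + 24 * D, by positivity⟩ ⟨M, hM⟩ (fun p => by
      change ‖Complex.I • (clip p.2 * G (transport p.1 p.2))‖ ≤ M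
      rw [norm_smul, Complex.norm_I, one_mul]
      refine (norm_mul_le _ _).trans ?_
      nlinarith [norm_clip_le p.2, hG.norm_le (transport p.1 p.2), norm_nonneg (clip p.2),
        norm_nonneg (G (transport p.1 p.2))]) (fun ρ x y => by
      change ‖Complex.I • (clip x * G (transport ρ x)) - Complex.I • (clip y * G (transport ρ y))‖
        ≤ (2 * M + 24 * D) * ‖x - y‖
      rw [← smul_sub, norm_smul, Complex.norm_I, one_mul]
      have e : clip x * G (transport ρ x) - clip y * G (transport ρ y) =
        (clip x - clip y) * G (transport ρ x) +
          clip y * (G (transport ρ x) - G (transport ρ y)) := by noncomm_ring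
      have h1 := hG.norm_sub_le _ _ (24 * ‖x - y‖) (by positivity) (norm_transport_sub_le ρ x y)
      have h2 : ‖(clip x - clip y) * G (transport ρ x)‖ ≤ 2 * ‖x - y‖ * M :=
        (norm_mul_le _ _).trans
          (mul_le_mul (norm_clip_sub_le x y) (hG.norm_le _) (norm_nonneg _) (by positivity))
      have h3 : ‖clip y * (G (transport ρ x) - G (transport ρ y))‖ ≤ 1 * (D * (24 * ‖x - y‖)) :=
        (norm_mul_le _ _).trans
          (mul_le_mul (norm_clip_le y) h1 (norm_nonneg _) zero_le_one)
      rw [e]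
      refine (norm_add_le _ _).trans ?_
      linarith) 1
  have hpt : ∀ t ρ, HasDerivAt (fun t => U t ρ)
      (Complex.I • (clip (U t ρ) * G (transport ρ (U t ρ)))) t := fun t ρ =>
    ((ContinuousMap.evalCLM ℝ ρ).hasFDerivAt.comp_hasDerivAt t (hU t) :)
  have huu : ∀ t ρ, U t ρ * star (U t ρ) = 1 := fun t ρ =>
    mul_star_eq_one_of_hasDerivAt (g := fun t => G (transport ρ (U t ρ)))
      (fun t => hG.isSelfAdjoint _) (fun t => hpt t ρ) (by rw [hU0]; rfl) t
  have hUc : Continuous U := continuous_iff_continuousAt.mpr fun t => (hU t).continuousAt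
  have hΦ : Continuous fun p : ℝ × State X => transport p.2 (U p.1 p.2) := by
    have : Continuous fun p : ℝ × State X => U p.1 p.2 := by fun_prop
    exact continuous_transport.comp (continuous_snd.prodMk this)
  -- Currying the jointly continuous map gives continuity in t for the compact-open topology.
  let Φ : C(ℝ, C(State X, State X)) := ContinuousMap.curry ⟨_, hΦ⟩
  refine ⟨U, Φ, hU0, huu, fun t ρ A => transport_apply_of_mul_star ρ (huu t ρ) A,
    Φ.continuous, fun t => ?_⟩
  convert hU t using 1
  ext ρ
  change Complex.I • (U t ρ * G (transport ρ (U t ρ))) =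
    Complex.I • (clip (U t ρ) * G (transport ρ (U t ρ)))
  rw [clip_of_norm_le (norm_le_one_of_mul_star (huu t ρ))]

/-! ### Uniqueness of the curves of states -/

/-- The norm-continuous w has a primitive in norm, which agrees with c up to a constant when tested
on each A. -/
theorem hasDerivAt_of_forall_apply {c w : ℝ → StrongDual ℂ X} (hw : Continuous w)
    (h : ∀ A t, HasDerivAt (fun t => c t A) (w t A) t) (t : ℝ) : HasDerivAt c (w t) t := by
  let b : ℝ → StrongDual ℂ X := fun t => ∫ s in (0 : ℝ)..t, w s
  have hb : ∀ t, HasDerivAt b (w t) t := fun t => (hw.integral_hasStrictDerivAt 0 t).hasDerivAt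
  have hconst : ∀ t, c t = c 0 + b t := by
    intro t
    ext A
    have hbA : ∀ t, HasDerivAt (fun t => b t A) (w t A) t := fun t =>
      ((ContinuousLinearMap.apply ℂ ℂ A).restrictScalars ℝ).hasFDerivAt.comp_hasDerivAt t (hb t)
    have hd : ∀ t, HasDerivAt (fun t => c t A - b t A) 0 t := fun t => by
      have := (h A t).sub (hbA t)
      rw [sub_self] at this
      exact this
    have hc := is_const_of_deriv_eq_zero (fun t => (hd t).differentiableAt)
      (fun t => (hd t).deriv) t 0
    have hb0 : b 0 = 0 := intervalIntegral.integral_same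
    simp only [hb0, _root_.zero_apply, sub_zero] at hc
    rw [_root_.add_apply, ← hc]
    ring
  have : c = fun t => c 0 + b t := funext hconst
  rw [this]
  exact (hb t).const_add _

/-- A state, as an element of the normed dual. -/
def State.toDual (ρ : State X) : StrongDual ℂ X := WeakDual.toStrongDual ρ.1

@[simp] theorem State.toDual_apply (ρ : State X) (A : X) : ρ.toDual A = ρ.1 A := rfl

theorem State.toDual_injective : Function.Injective (State.toDual (X := X)) := fun _ _ h =>
  state_ext fun A => DFunLike.congr_fun h A

theorem State.norm_toDual_le (ρ : State X) : ‖ρ.toDual‖ ≤ 2 :=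
  ContinuousLinearMap.opNorm_le_bound _ zero_le_two (norm_apply_le ρ)

section Curves

variable {G : State X → X} {D M : ℝ}

/-- `c` is an integral curve of states of the field `ρ ↦ ρ(i [G ρ, ·])`. -/
def IsStateCurve (G : State X → X) (c : ℝ → State X) : Prop :=
  ∀ (A : X) (t : ℝ), HasDerivAt (fun t => (c t).1 A) ((c t).1 (commutator (G (c t)) A)) t

theorem commutator_sub (g g' A : X) : commutator (g - g') A = commutator g A - commutator g' A := by
  simp only [commutator_apply]
  rw [← smul_sub]
  congr 1
  noncomm_ring

/-- Changing the state costs 2M, the norm bound of the commutator; changing the field costs 4D,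
where one factor 2 is the commutator and the other the norm bound of a state. -/
theorem norm_comp_commutator_sub_le (hG : IsLipschitzField G D M) (ρ υ : State X) :
    ‖ρ.toDual.comp (commutator (G ρ)) - υ.toDual.comp (commutator (G υ))‖ ≤
      (2 * M + 4 * D) * ‖ρ.toDual - υ.toDual‖ := by
  have hM := hG.bound_nonneg
  have hD := hG.const_nonneg
  refine ContinuousLinearMap.opNorm_le_bound _ (by positivity) fun A => ?_
  have e : (ρ.toDual.comp (commutator (G ρ)) - υ.toDual.comp (commutator (G υ))) A =
      (ρ.toDual - υ.toDual) (commutator (G ρ) A) + υ.toDual (commutator (G ρ - G υ) A) := by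
    rw [commutator_sub, map_sub]
    simp
  have h1 := (ρ.toDual - υ.toDual).le_opNorm (commutator (G ρ) A)
  have h2 := υ.toDual.le_opNorm (commutator (G ρ - G υ) A)
  have h3 := norm_commutator_le (G ρ) A
  have h4 := norm_commutator_le (G ρ - G υ) A
  have h5 := hG.norm_sub_le ρ υ ‖ρ.toDual - υ.toDual‖ (norm_nonneg _)
    fun A => (ρ.toDual - υ.toDual).le_opNorm A
  have h6 := υ.norm_toDual_le
  have h7 : ‖commutator (G ρ) A‖ ≤ 2 * M * ‖A‖ := h3.trans (by
    have := hG.norm_le ρ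
    gcongr)
  have h8 : ‖commutator (G ρ - G υ) A‖ ≤ 2 * (D * ‖ρ.toDual - υ.toDual‖) * ‖A‖ :=
    h4.trans (by gcongr)
  rw [e]
  calc _ ≤ ‖ρ.toDual - υ.toDual‖ * (2 * M * ‖A‖) +
        2 * (2 * (D * ‖ρ.toDual - υ.toDual‖) * ‖A‖) := by
        refine (norm_add_le _ _).trans (add_le_add (h1.trans ?_) (h2.trans ?_))
        · gcongr
        · gcongr
    _ = _ := by ring

/-- A bootstrap: the pointwise derivatives are at most 4M‖A‖, so the curve is Lipschitz in the dual
norm. Hence its velocity is norm-continuous, and the pointwise derivative is a norm derivative. -/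
theorem IsStateCurve.hasDerivAt (hG : IsLipschitzField G D M) {c : ℝ → State X}
    (hc : IsStateCurve G c) (t : ℝ) : HasDerivAt (fun t => (c t).toDual)
      ((c t).toDual.comp (commutator (G (c t)))) t := by
  have hM := hG.bound_nonneg
  have hD := hG.const_nonneg
  have hlip : ∀ s t, ‖(c t).toDual - (c s).toDual‖ ≤ 4 * M * ‖t - s‖ := by
    intro s t
    refine ContinuousLinearMap.opNorm_le_bound _ (by positivity) fun A => ?_
    have := Convex.norm_image_sub_le_of_norm_hasDerivWithin_le (s := Set.univ) (x := s) (y := t)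
      (C := 4 * M * ‖A‖) (fun x _ => (hc A x).hasDerivWithinAt) (fun x _ => by
        refine (norm_apply_le _ _).trans ?_
        have h1 := norm_commutator_le (G (c x)) A
        have h2 := mul_le_mul_of_nonneg_right (hG.norm_le (c x)) (norm_nonneg A)
        linarith) convex_univ trivial trivial
    refine le_trans this (le_of_eq (by ring))
  have hcont : Continuous fun t => (c t).toDual := by
    have : LipschitzWith ⟨4 * M, by positivity⟩ fun t => (c t).toDual :=
      LipschitzWith.of_dist_le_mul fun t s => by
        rw [dist_eq_norm, dist_eq_norm]; exact hlip s t
    exact this.continuous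
  refine hasDerivAt_of_forall_apply (c := fun t => (c t).toDual)
    (w := fun t => (c t).toDual.comp (commutator (G (c t)))) ?_ (fun A t => hc A t) t
  refine continuous_iff_continuousAt.mpr fun t => ?_
  rw [ContinuousAt, tendsto_iff_norm_sub_tendsto_zero]
  refine squeeze_zero (fun _ => norm_nonneg _)
    (fun s => norm_comp_commutator_sub_le hG (c s) (c t)) ?_
  have := (tendsto_iff_norm_sub_tendsto_zero.mp (hcont.tendsto t)).const_mul (2 * M + 4 * D)
  simpa using this

open scoped Classical in
/-- The field `ρ ↦ ρ(i [G ρ, ·])` on states, extended by zero to the dual. -/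
def dualField (G : State X → X) (ψ : StrongDual ℂ X) : StrongDual ℂ X :=
  if H : ∃ ρ : State X, ρ.toDual = ψ then ψ.comp (commutator (G H.choose)) else 0

theorem dualField_toDual (G : State X → X) (ρ : State X) :
    dualField G ρ.toDual = ρ.toDual.comp (commutator (G ρ)) := by
  have H : ∃ υ : State X, υ.toDual = ρ.toDual := ⟨ρ, rfl⟩
  rw [dualField, dif_pos H, State.toDual_injective H.choose_spec]

/-- Lipschitz continuity on the set of states is enough, because both curves stay in it. -/
theorem IsStateCurve.unique (hG : IsLipschitzField G D M) {c c' : ℝ → State X}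
    (hc : IsStateCurve G c) (hc' : IsStateCurve G c') {t₀ : ℝ} (h : c t₀ = c' t₀) : c = c' := by
  have hM := hG.bound_nonneg
  have hD := hG.const_nonneg
  have hlip : LipschitzOnWith ⟨2 * M + 4 * D, by positivity⟩ (dualField G)
      (Set.range State.toDual) := by
    refine LipschitzOnWith.of_dist_le_mul ?_
    rintro _ ⟨ρ, rfl⟩ _ ⟨υ, rfl⟩
    rw [dist_eq_norm, dist_eq_norm, dualField_toDual, dualField_toDual]
    exact norm_comp_commutator_sub_le hG ρ υ
  have := ODE_solution_unique_univ (v := fun _ => dualField G)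
    (s := fun _ => Set.range State.toDual) (t₀ := t₀)
    (f := fun t => (c t).toDual) (g := fun t => (c' t).toDual) (fun _ => hlip)
    (fun t => ⟨by rw [dualField_toDual]; exact hc.hasDerivAt hG t, ⟨_, rfl⟩⟩)
    (fun t => ⟨by rw [dualField_toDual]; exact hc'.hasDerivAt hG t, ⟨_, rfl⟩⟩)
    (congrArg State.toDual h)
  exact funext fun t => State.toDual_injective (congrFun this t)

theorem IsStateCurve.comp_add_const {c : ℝ → State X} (hc : IsStateCurve G c) (s : ℝ) :
    IsStateCurve G fun t => c (t + s) := fun A t => (hc A (t + s)).comp_add_const t s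

end Curves

/-! ### The flow -/

theorem hasDerivAt_conjugation {u : ℝ → X} {g : X} {t : ℝ} (hg : IsSelfAdjoint g)
    (hu : HasDerivAt u (Complex.I • (u t * g)) t) :
    HasDerivAt (fun t => conjugation (u t)) ((conjugation (u t)).comp (commutator g)) t := by
  let L : X →L[ℝ] X →L[ℂ] X := (ContinuousLinearMap.mul ℂ X).restrictScalars ℝ
  let R : X →L[ℝ] X →L[ℂ] X := (ContinuousLinearMap.mul ℂ X).flip.restrictScalars ℝ
  have e : (fun t => conjugation (u t)) = fun t => L (u t) * R (star (u t)) := by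
    funext t
    ext A
    simp [L, R, mul_assoc]
  have h1 := L.hasFDerivAt.comp_hasDerivAt t hu
  have h2 := R.hasFDerivAt.comp_hasDerivAt t hu.star
  have h3 : HasDerivAt (fun t => L (u t) * R (star (u t))) _ t := h1.mul h2
  rw [e]
  refine h3.congr_deriv ?_
  ext A
  simp [L, R, commutator_apply, hg.star_eq, mul_assoc, sub_eq_add_neg, mul_add, add_mul]

/-- The map `C(E; X) → C(E; ℂ)`, `W ↦ (ρ ↦ ρ(W(ρ)))`. -/
def evalField : C(State X, X) →L[ℂ] C(State X, ℂ) :=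
  LinearMap.mkContinuous
    { toFun := fun W => ⟨fun ρ => ρ.1 (W ρ),
        continuous_apply_apply.comp (continuous_id.prodMk W.continuous)⟩
      map_add' := fun W W' => by ext ρ; exact map_add ρ.1 _ _
      map_smul' := fun z W => by ext ρ; exact map_smul ρ.1 _ _ } 2 fun W => by
    rw [ContinuousMap.norm_le _ (by positivity)]
    exact fun ρ => (norm_apply_le ρ _).trans
      (mul_le_mul_of_nonneg_left (W.norm_coe_le_norm ρ) zero_le_two)

@[simp] theorem evalField_apply (W : C(State X, X)) (ρ : State X) :
    evalField W ρ = ρ.1 (W ρ) := rfl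

/-- The field `ρ ↦ i [G ρ, W ρ]`. -/
def commutatorField (G W : C(State X, X)) : C(State X, X) := Complex.I • (G * W - W * G)

/-- The function `ρ ↦ ρ(i [G ρ, W ρ])`. -/
def pairing (G W : C(State X, X)) : C(State X, ℂ) := evalField (commutatorField G W)

theorem pairing_apply (G W : C(State X, X)) (ρ : State X) :
    pairing G W ρ = ρ.1 (commutator (G ρ) (W ρ)) := rfl

/-- `Φ` is the flow of the field `ρ ↦ ρ(i [G ρ, ·])` on the state space. -/
structure IsStateFlow (G : C(State X, X)) (Φ : ℝ → C(State X, State X)) : Prop where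
  continuous : Continuous Φ
  zero : Φ 0 = ContinuousMap.id _
  add : ∀ s t, Φ (s + t) = (Φ t).comp (Φ s)
  isStateCurve : ∀ ρ, IsStateCurve G fun t => Φ t ρ
  hasDerivAt_hat : ∀ A, HasDerivAt (fun t => (hat A).comp (Φ t))
    (pairing G (ContinuousMap.const _ A)) 0
  exists_evolution : ∀ ρ, ∃ W : ℝ → X →L[ℂ] X, W 0 = ContinuousLinearMap.id ℂ X ∧
    (∀ t A, (Φ t ρ).1 A = ρ.1 (W t A)) ∧
    ∀ t, HasDerivAt W ((W t).comp (commutator (G (Φ t ρ)))) t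

/-- The propagator is differentiable in C(E; X), so derivatives of Â ∘ Φ_t hold uniformly in the
state. The group law comes from uniqueness of integral curves. -/
theorem exists_isStateFlow {G : C(State X, X)} {D M : ℝ} (hG : IsLipschitzField G D M) :
    ∃ Φ, IsStateFlow G Φ := by
  obtain ⟨U, Φ, hU0, hUU, hΦ, hcont, hU⟩ := exists_propagator hG
  have hpt : ∀ t ρ, HasDerivAt (fun t => U t ρ) (Complex.I • (U t ρ * G (Φ t ρ))) t := fun t ρ =>
    ((ContinuousMap.evalCLM ℝ ρ).hasFDerivAt.comp_hasDerivAt t (hU t) :)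
  have hconj : ∀ t ρ, HasDerivAt (fun t => conjugation (U t ρ))
      ((conjugation (U t ρ)).comp (commutator (G (Φ t ρ)))) t := fun t ρ =>
    hasDerivAt_conjugation (u := fun t => U t ρ) (hG.isSelfAdjoint _) (hpt t ρ)
  have h0 : Φ 0 = ContinuousMap.id _ := by
    refine ContinuousMap.ext fun ρ => state_ext fun A => ?_
    rw [hΦ, hU0]
    simp
  have hcurve : ∀ ρ, IsStateCurve G fun t => Φ t ρ := by
    intro ρ A t
    have h1 := ((ContinuousLinearMap.apply ℂ X A).restrictScalars ℝ).hasFDerivAt.comp_hasDerivAt t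
      (hconj t ρ)
    have h2 := (ρ.toDual.restrictScalars ℝ).hasFDerivAt.comp_hasDerivAt t h1
    have e : (fun t => (Φ t ρ).1 A) = fun t => ρ.toDual (conjugation (U t ρ) A) :=
      funext fun t => hΦ t ρ A
    rw [e, hΦ t ρ]
    exact h2
  refine ⟨Φ, hcont, h0, ?_, hcurve, ?_, ?_⟩
  · intro s t
    ext1 ρ
    have := IsStateCurve.unique hG (c := fun t => Φ (t + s) ρ) (c' := fun t => Φ t (Φ s ρ))
      ((hcurve ρ).comp_add_const s) (hcurve _) (t₀ := 0) (by simp [h0])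
    rw [add_comm]
    exact congrFun this t
  · intro A
    have h1 := (hU 0).mul_const (ContinuousMap.const (State X) A)
    have h2 := h1.mul (hU 0).star
    have e : (fun t => (hat A).comp (Φ t)) =
        fun t => evalField (U t * ContinuousMap.const (State X) A * star (U t)) := by
      funext t
      ext ρ
      exact hΦ t ρ A
    have h3 := (evalField.restrictScalars ℝ).hasFDerivAt.comp_hasDerivAt (0 : ℝ) h2
    have h4 : HasDerivAt
        (fun t => evalField (U t * ContinuousMap.const (State X) A * star (U t))) _ 0 := h3
    rw [e]
    refine h4.congr_deriv ?_
    ext ρ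
    have hsa : star (G ρ) = G ρ := hG.isSelfAdjoint ρ
    simp [pairing, commutatorField, hU0, h0, hsa, sub_eq_add_neg]
  · intro ρ
    refine ⟨fun t => conjugation (U t ρ), ?_, fun t A => hΦ t ρ A, fun t => hconj t ρ⟩
    ext A
    simp [hU0]

/-! ### Generators of groups of isometries -/

section Groups

variable {F : Type*} [NormedAddCommGroup F] [NormedSpace ℂ F] {U : ℝ → F →L[ℂ] F}

theorem hasDerivAt_generator_zero (x : (generator U).domain) :
    HasDerivAt (fun t => U t (x : F)) (generator U x) 0 :=
  DifferentiableAt.hasDerivAt x.2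

theorem exists_generator_eq {x y : F} (h : HasDerivAt (fun t => U t x) y 0) :
    ∃ hx : x ∈ (generator U).domain, generator U ⟨x, hx⟩ = y :=
  ⟨h.differentiableAt, h.deriv⟩

theorem IsC0Group.hasDerivAt (hU : IsC0Group U) (x : (generator U).domain) (t : ℝ) :
    HasDerivAt (fun t => U t (x : F)) (U t (generator U x)) t := by
  have h0 : HasDerivAt (fun s => U s (x : F)) (generator U x) (t - t) := by
    rw [sub_self]; exact hasDerivAt_generator_zero x
  have h1 := (((U t).restrictScalars ℝ).hasFDerivAt.comp_hasDerivAt t (h0.comp_sub_const t t) :)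
  have e : (fun s => U s (x : F)) = fun s => (U t).restrictScalars ℝ (U (s - t) (x : F)) := by
    funext s
    change U s (x : F) = ((U t).comp (U (s - t))) (x : F)
    rw [← hU.add, add_sub_cancel]
  rw [e]
  exact h1

theorem IsC0Group.exists_generator_apply_eq (hU : IsC0Group U) (x : (generator U).domain) (t : ℝ) :
    ∃ hx : U t (x : F) ∈ (generator U).domain,
      generator U ⟨U t (x : F), hx⟩ = U t (generator U x) := by
  refine exists_generator_eq ?_
  have h1 := (((U t).restrictScalars ℝ).hasFDerivAt.comp_hasDerivAt 0
    (hasDerivAt_generator_zero x) :)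
  have e : (fun s => U s (U t (x : F))) = fun s => (U t).restrictScalars ℝ (U s (x : F)) := by
    funext s
    change ((U s).comp (U t)) (x : F) = ((U t).comp (U s)) (x : F)
    rw [← hU.add, ← hU.add, add_comm]
  rw [e]
  exact h1

/-- Replacing y by a difference quotient turns the right-hand side into ‖(l + 1/t) u(0) - u(t)/t‖,
which is at least l‖u(0)‖ because ‖u(t)‖ ≤ ‖u(0)‖. -/
theorem mul_norm_le_of_hasDerivAt {u : ℝ → F} {y : F} (hu : HasDerivAt u y 0)
    (h : ∀ t, ‖u t‖ ≤ ‖u 0‖) (l : ℝ) : l * ‖u 0‖ ≤ ‖(l : ℂ) • u 0 - y‖ := by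
  have h1 := hu.tendsto_slope_zero_right
  have h2 : Tendsto (fun t : ℝ => ‖(l : ℂ) • u 0 - t⁻¹ • (u (0 + t) - u 0)‖) (𝓝[>] 0)
      (𝓝 ‖(l : ℂ) • u 0 - y‖) := (tendsto_const_nhds.sub h1).norm
  refine ge_of_tendsto h2 ?_
  filter_upwards [self_mem_nhdsWithin] with t (ht : 0 < t)
  have e : (l : ℂ) • u 0 - t⁻¹ • (u (0 + t) - u 0) = (l + t⁻¹) • u 0 - t⁻¹ • u (0 + t) := by
    rw [Complex.coe_smul, smul_sub, add_smul]; abel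
  have ht' : 0 < t⁻¹ := inv_pos.mpr ht
  rw [e]
  have h3 := norm_sub_norm_le ((l + t⁻¹) • u 0) (t⁻¹ • u (0 + t))
  rw [norm_smul, norm_smul, Real.norm_of_nonneg ht'.le] at h3
  have h4 := mul_le_mul_of_nonneg_left (h (0 + t)) ht'.le
  have h5 := mul_le_mul_of_nonneg_right (Real.le_norm_self (l + t⁻¹)) (norm_nonneg (u 0))
  linarith

theorem hasDerivAt_comp_neg {u : ℝ → F} {y : F} {t : ℝ} (h : HasDerivAt u y (-t)) :
    HasDerivAt (fun t => u (-t)) (-y) t := by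
  have := h.scomp t (hasDerivAt_neg t)
  rw [neg_one_smul] at this
  exact this

theorem IsC0Group.isConservative_generator (hU : IsC0Group U) (hn : ∀ t x, ‖U t x‖ ≤ ‖x‖) :
    IsConservative (generator U) := by
  have h0 : ∀ x, U 0 x = x := fun x => by rw [hU.zero]; rfl
  constructor
  · intro x l _
    have := mul_norm_le_of_hasDerivAt (hasDerivAt_generator_zero x)
      (fun t => by rw [h0]; exact hn t _) l
    rwa [h0] at this
  · intro x l _
    have h1 : HasDerivAt (fun t => U (-t) (x : F)) (-generator U x) 0 := by
      have h2 : HasDerivAt (fun t => U t (x : F)) (generator U x) (-0) := by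
        rw [neg_zero]; exact hasDerivAt_generator_zero x
      exact hasDerivAt_comp_neg h2
    have := mul_norm_le_of_hasDerivAt h1 (fun t => by rw [neg_zero, h0]; exact hn _ _) l
    simp only [neg_zero, h0] at this
    exact this

theorem IsConservative.mono {L L' : F →ₗ.[ℂ] F} (h : IsConservative L') (hL : L ≤ L') :
    IsConservative L :=
  ⟨fun x l hl => by
    have := h.1 ⟨x, hL.1 x.2⟩ l hl
    rwa [← hL.2 (x := x) (y := ⟨x, hL.1 x.2⟩) rfl] at this, fun x l hl => by
    have := h.2 ⟨x, hL.1 x.2⟩ l hl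
    rwa [LinearPMap.neg_apply, ← hL.2 (x := x) (y := ⟨x, hL.1 x.2⟩) rfl] at this⟩

/-- If xₙ → x and L xₙ → y, contractivity makes the derivatives U_t L xₙ of U_t xₙ converge
uniformly in t, so the limit may be differentiated. -/
theorem IsC0Group.isClosed_generator (hU : IsC0Group U) (hn : ∀ t x, ‖U t x‖ ≤ ‖x‖) :
    (generator U).IsClosed := by
  refine isClosed_of_closure_subset ?_
  rintro ⟨x, y⟩ hxy
  obtain ⟨p, hp, hlim⟩ := mem_closure_iff_seq_limit.mp hxy
  rw [Prod.tendsto_iff] at hlim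
  have hp' : ∀ n, ∃ hx : (p n).1 ∈ (generator U).domain, generator U ⟨_, hx⟩ = (p n).2 := by
    intro n
    obtain ⟨z, hz1, hz2⟩ := (LinearPMap.mem_graph_iff _).mp (hp n)
    have : (p n).1 ∈ (generator U).domain := hz1 ▸ z.2
    refine ⟨this, ?_⟩
    rw [← hz2]
    congr 1
    exact Subtype.ext hz1.symm
  have hd : ∀ n t, HasDerivAt (fun t => U t (p n).1) (U t (p n).2) t := by
    intro n t
    obtain ⟨hx, e⟩ := hp' n
    rw [← e]
    exact hU.hasDerivAt ⟨_, hx⟩ t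
  have hunif : TendstoUniformly (fun n t => U t (p n).2) (fun t => U t y) atTop := by
    rw [Metric.tendstoUniformly_iff]
    intro ε hε
    have := (Metric.tendsto_nhds.mp hlim.2) ε hε
    filter_upwards [this] with n hn' t
    rw [dist_comm, dist_eq_norm, ← map_sub]
    rw [dist_eq_norm] at hn'
    exact (hn t _).trans_lt hn'
  have := hasDerivAt_of_tendstoUniformly hunif (Eventually.of_forall hd)
    (fun t => ((U t).continuous.tendsto x).comp hlim.1) 0
  have h0 : U 0 y = y := by rw [hU.zero]; rfl
  rw [h0] at this
  obtain ⟨hx, e⟩ := exists_generator_eq this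
  exact (LinearPMap.mem_graph_iff _).mpr ⟨⟨x, hx⟩, rfl, e⟩

/-- As u(x + τ) = u(x) + τ v(x) + o(τ), the hypothesis makes ‖u(x + τ)‖ ≥ ‖u(x)‖ - o(τ). Right
slopes of -‖u‖ are thus eventually below any r > 0, and -‖u‖ cannot increase. -/
theorem norm_le_norm_of_hasDerivAt {u v : ℝ → F} (hu : ∀ t, HasDerivAt u (v t) t)
    (h : ∀ t τ : ℝ, 0 < τ → ‖u t‖ ≤ ‖u t + τ • v t‖) {a b : ℝ} (hab : a ≤ b) :
    ‖u a‖ ≤ ‖u b‖ := by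
  have hc : Continuous u := continuous_iff_continuousAt.mpr fun t => (hu t).continuousAt
  have key := image_le_of_liminf_slope_right_le_deriv_boundary (f := fun t => -‖u t‖) (a := a)
    (b := b) hc.norm.neg.continuousOn (B := fun _ => -‖u a‖) (B' := fun _ => 0) le_rfl
    continuousOn_const (fun x _ => hasDerivWithinAt_const _ _ _) ?_
  · have := key (Set.right_mem_Icc.mpr hab)
    exact neg_le_neg_iff.mp this
  · intro x _ r hr
    have h1 := ((hasDerivAt_iff_isLittleO.mp (hu x)).def (half_pos hr)).filter_mono
      (nhdsWithin_le_nhds (s := Set.Ioi x))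
    refine Eventually.frequently ?_
    filter_upwards [h1, self_mem_nhdsWithin] with z hz (hxz : x < z)
    have hz0 : 0 < z - x := sub_pos.mpr hxz
    rw [Real.norm_of_nonneg hz0.le] at hz
    have h2 := h x (z - x) hz0
    have h3 : ‖u x + (z - x) • v x‖ - ‖u z‖ ≤ ‖u z - u x - (z - x) • v x‖ := by
      rw [norm_sub_rev (u z - u x)]
      refine (norm_sub_norm_le _ _).trans (le_of_eq ?_)
      congr 1
      abel
    rw [slope_def_field, div_lt_iff₀ hz0]
    nlinarith

theorem IsDissipative.norm_le {L : F →ₗ.[ℂ] F} (h : IsDissipative L) (x : L.domain) {τ : ℝ}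
    (hτ : 0 < τ) : ‖(x : F)‖ ≤ ‖(x : F) - τ • L x‖ := by
  have h1 := mul_le_mul_of_nonneg_left (h x τ⁻¹ (inv_pos.mpr hτ)) hτ.le
  rw [← mul_assoc, mul_inv_cancel₀ hτ.ne', one_mul] at h1
  refine h1.trans (le_of_eq ?_)
  have : (x : F) - τ • L x = τ • (((τ⁻¹ : ℝ) : ℂ) • (x : F) - L x) := by
    rw [smul_sub, Complex.coe_smul, smul_smul, mul_inv_cancel₀ hτ.ne', one_smul]
  rw [this, norm_smul, Real.norm_of_nonneg hτ.le]

/-- A group with a conservative generator is isometric. -/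
theorem IsC0Group.norm_apply_of_isConservative (hU : IsC0Group U)
    (hL : IsConservative (generator U)) (x : (generator U).domain) (t : ℝ) :
    ‖U t (x : F)‖ = ‖(x : F)‖ := by
  have h0 : U 0 (x : F) = x := by rw [hU.zero]; rfl
  have hd := hU.hasDerivAt x
  have hd' : ∀ t, HasDerivAt (fun t => U (-t) (x : F)) (-U (-t) (generator U x)) t := fun t =>
    hasDerivAt_comp_neg (hd (-t))
  -- Dissipativity of -L makes the norm nondecreasing along the orbit; dissipativity of L does so
  -- along the reversed orbit.
  have h1 : ∀ a b : ℝ, a ≤ b → ‖U a (x : F)‖ ≤ ‖U b (x : F)‖ := fun a b hab =>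
    norm_le_norm_of_hasDerivAt (u := fun t => U t (x : F)) hd (fun t τ hτ => by
      obtain ⟨hx, e⟩ := hU.exists_generator_apply_eq x t
      have := hL.2.norm_le ⟨_, hx⟩ hτ
      rw [LinearPMap.neg_apply, e] at this
      simpa using this) hab
  have h2 : ∀ a b : ℝ, a ≤ b → ‖U (-a) (x : F)‖ ≤ ‖U (-b) (x : F)‖ := fun a b hab =>
    norm_le_norm_of_hasDerivAt (u := fun t => U (-t) (x : F)) hd' (fun t τ hτ => by
      obtain ⟨hx, e⟩ := hU.exists_generator_apply_eq x (-t)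
      have := hL.1.norm_le ⟨_, hx⟩ hτ
      rw [e] at this
      simpa [sub_eq_add_neg] using this) hab
  rcases le_total 0 t with ht | ht
  · have a1 := h1 0 t ht
    have a2 := h2 (-t) (-0) (by linarith)
    simp only [neg_neg, h0] at a1 a2
    exact le_antisymm a2 a1
  · have a1 := h1 t 0 ht
    have a2 := h2 0 (-t) (by linarith)
    simp only [neg_neg, neg_zero, h0] at a1 a2
    exact le_antisymm a1 a2

end Groups

/-! ### Polynomials -/

theorem continuous_mix (ρ υ : State X) : Continuous (mix ρ υ) := by
  refine continuous_state_iff.mpr fun A => ?_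
  change Continuous fun l : unitInterval =>
    ((1 - (l : ℝ) : ℝ) : ℂ) * ρ.1 A + ((l : ℝ) : ℂ) * υ.1 A
  fun_prop

theorem mix_zero (ρ υ : State X) : mix ρ υ 0 = ρ := by
  refine state_ext fun A => ?_
  change ((1 - ((0 : unitInterval) : ℝ) : ℝ) : ℂ) * ρ.1 A +
    (((0 : unitInterval) : ℝ) : ℂ) * υ.1 A = ρ.1 A
  simp

/-- `W` is the gradient `ρ ↦ Df(ρ)` of `f`. -/
def HasGradient (f : C(State X, ℂ)) (W : C(State X, X)) : Prop :=
  ∀ ρ, HasGateauxDerivAt f (hat (W ρ)) ρ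

/-- The difference quotient is constantly υ(A) - ρ(A), which is υ(A - ρ(A) 1) because υ(1) = 1. -/
theorem hasGradient_hat (A : X) : HasGradient (hat A) (ContinuousMap.const _ A -
    ⟨fun ρ => ρ.1 A • (1 : X), (hat A).continuous.smul continuous_const⟩) := by
  refine fun ρ => ⟨isAffine_hat _, fun υ => ?_⟩
  have e : hat ((ContinuousMap.const (State X) A -
      ⟨fun ρ => ρ.1 A • (1 : X), (hat A).continuous.smul continuous_const⟩ : C(State X, X)) ρ) υ =
      υ.1 A - ρ.1 A := by
    change υ.1 (A - ρ.1 A • (1 : X)) = _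
    rw [map_sub, map_smul, υ.2.2, smul_eq_mul, mul_one]
  rw [e]
  refine tendsto_const_nhds.congr' ?_
  filter_upwards [self_mem_nhdsWithin] with l (hl : 0 < l)
  have hl' : ((l : ℝ) : ℂ) ≠ 0 := Complex.ofReal_ne_zero.mpr (Subtype.coe_lt_coe.mpr hl).ne'
  have e2 : hat A (mix ρ υ l) = ((1 - (l : ℝ) : ℝ) : ℂ) * ρ.1 A + ((l : ℝ) : ℂ) * υ.1 A := rfl
  have e3 : hat A ρ = ρ.1 A := rfl
  rw [e2, e3, Complex.real_smul]
  push_cast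
  field_simp
  ring

theorem hasGradient_const (z : ℂ) :
    HasGradient (algebraMap ℂ C(State X, ℂ) z) (0 : C(State X, X)) := by
  refine fun ρ => ⟨isAffine_hat _, fun υ => ?_⟩
  have e : hat ((0 : C(State X, X)) ρ) υ = 0 := map_zero υ.1
  rw [e]
  refine tendsto_const_nhds.congr fun l => ?_
  have h : ∀ ρ : State X, algebraMap ℂ C(State X, ℂ) z ρ = z := fun _ => rfl
  rw [h, h, sub_self, smul_zero]

theorem HasGradient.add {f g : C(State X, ℂ)} {W W' : C(State X, X)} (hf : HasGradient f W)
    (hg : HasGradient g W') : HasGradient (f + g) (W + W') := by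
  refine fun ρ => ⟨isAffine_hat _, fun υ => ?_⟩
  have e : hat ((W + W') ρ) υ = hat (W ρ) υ + hat (W' ρ) υ := map_add υ.1 _ _
  rw [e]
  refine (((hf ρ).2 υ).add ((hg ρ).2 υ)).congr fun l => ?_
  rw [← smul_add]
  congr 1
  simp only [ContinuousMap.add_apply]
  ring

/-- The field `ρ ↦ f(ρ) W(ρ)`. -/
def mulField (f : C(State X, ℂ)) (W : C(State X, X)) : C(State X, X) :=
  ⟨fun ρ => f ρ • W ρ, f.continuous.smul W.continuous⟩

theorem HasGradient.mul {f g : C(State X, ℂ)} {W W' : C(State X, X)} (hf : HasGradient f W)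
    (hg : HasGradient g W') : HasGradient (f * g) (mulField f W' + mulField g W) := by
  refine fun ρ => ⟨isAffine_hat _, fun υ => ?_⟩
  have e : hat ((mulField f W' + mulField g W) ρ) υ =
      f ρ * hat (W' ρ) υ + hat (W ρ) υ * g ρ := by
    change υ.1 (f ρ • W' ρ + g ρ • W ρ) = f ρ * υ.1 (W' ρ) + υ.1 (W ρ) * g ρ
    rw [map_add, map_smul, map_smul, smul_eq_mul, smul_eq_mul, mul_comm (g ρ)]
  have hlim : Tendsto (fun l => f (mix ρ υ l)) (𝓝[>] 0) (𝓝 (f ρ)) := by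
    have := (f.continuous.comp (continuous_mix ρ υ)).tendsto 0
    simp only [Function.comp_apply, mix_zero] at this
    exact this.mono_left nhdsWithin_le_nhds
  rw [e]
  refine ((hlim.mul ((hg ρ).2 υ)).add (((hf ρ).2 υ).mul_const (g ρ))).congr fun l => ?_
  simp only [ContinuousMap.mul_apply, Complex.real_smul]
  ring

theorem pairing_add (G W W' : C(State X, X)) : pairing G (W + W') = pairing G W + pairing G W' := by
  ext ρ
  change ρ.1 (commutator (G ρ) (W ρ + W' ρ)) = _
  rw [map_add, map_add]
  rfl

theorem pairing_mulField (G : C(State X, X)) (f : C(State X, ℂ)) (W : C(State X, X)) :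
    pairing G (mulField f W) = f * pairing G W := by
  ext ρ
  change ρ.1 (commutator (G ρ) (f ρ • W ρ)) = _
  rw [map_smul, map_smul]
  rfl

theorem pairing_zero (G : C(State X, X)) : pairing G 0 = 0 := by
  ext ρ
  change ρ.1 (commutator (G ρ) 0) = 0
  rw [map_zero, map_zero]

/-- Polynomials have gradients, and are differentiable along the flow of `G`. -/
theorem IsStateFlow.exists_hasGradient {G : C(State X, X)} {Φ : ℝ → C(State X, State X)}
    (hΦ : IsStateFlow G Φ) {f : C(State X, ℂ)} (hf : f ∈ polynomials (Set.univ : Set X)) :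
    ∃ W : C(State X, X), HasGradient f W ∧
      HasDerivAt (fun t => f.comp (Φ t)) (pairing G W) 0 := by
  induction hf using Algebra.adjoin_induction with
  | mem f hf =>
    obtain ⟨A, -, rfl⟩ := hf
    refine ⟨_, hasGradient_hat A, (hΦ.hasDerivAt_hat A).congr_deriv ?_⟩
    ext ρ
    change ρ.1 (commutator (G ρ) A) = ρ.1 (commutator (G ρ) (A - ρ.1 A • (1 : X)))
    have : commutator (G ρ) (ρ.1 A • (1 : X)) = 0 := by
      simp [commutator_apply]
    rw [map_sub, this, sub_zero]
  | algebraMap z =>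
    refine ⟨0, hasGradient_const z, ?_⟩
    rw [pairing_zero]
    exact hasDerivAt_const 0 (algebraMap ℂ C(State X, ℂ) z)
  | add f g _ _ hf hg =>
    obtain ⟨W, h1, h2⟩ := hf
    obtain ⟨W', h3, h4⟩ := hg
    refine ⟨_, h1.add h3, ?_⟩
    rw [pairing_add]
    exact h2.add h4
  | mul f g _ _ hf hg =>
    obtain ⟨W, h1, h2⟩ := hf
    obtain ⟨W', h3, h4⟩ := hg
    refine ⟨_, h1.mul h3, ?_⟩
    have h5 : HasDerivAt (fun t => f.comp (Φ t) * g.comp (Φ t)) _ 0 := h2.mul h4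
    refine h5.congr_deriv ?_
    rw [pairing_add, pairing_mulField, pairing_mulField, hΦ.zero]
    change pairing G W * g + f * pairing G W' = _
    ring

theorem star_mem_polynomials {f : C(State X, ℂ)} (hf : f ∈ polynomials (Set.univ : Set X)) :
    star f ∈ polynomials (Set.univ : Set X) := by
  induction hf using Algebra.adjoin_induction with
  | mem f hf =>
    obtain ⟨A, -, rfl⟩ := hf
    have : star (hat A) = hat (star A) := by
      ext ρ
      exact (apply_star ρ A).symm
    rw [this]
    exact Algebra.subset_adjoin ⟨_, trivial, rfl⟩
  | algebraMap z =>
    rw [← algebraMap_star_comm]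
    exact Subalgebra.algebraMap_mem _ _
  | add f g _ _ hf hg => rw [star_add]; exact add_mem hf hg
  | mul f g _ _ hf hg => rw [star_mul]; exact mul_mem hg hf

/-- Stone-Weierstrass: the functions Â separate states by definition. -/
theorem dense_polynomials : Dense (polynomials (Set.univ : Set X) : Set C(State X, ℂ)) := by
  let S : StarSubalgebra ℂ C(State X, ℂ) :=
    { polynomials (Set.univ : Set X) with star_mem' := star_mem_polynomials }
  have hS : S.SeparatesPoints := by
    intro ρ υ hne
    by_contra hcon
    push Not at hcon
    refine hne (state_ext fun A => ?_)
    exact hcon _ ⟨hat A, Algebra.subset_adjoin ⟨A, trivial, rfl⟩, rfl⟩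
  have h := ContinuousMap.starSubalgebra_topologicalClosure_eq_top_of_separatesPoints S hS
  have h2 : closure (S : Set C(State X, ℂ)) = Set.univ := by
    rw [← StarSubalgebra.topologicalClosure_coe, h]
    rfl
  exact dense_iff_closure_eq.mpr h2

/-! ### The classical dynamics -/

section Dynamics

variable {G : C(State X, X)} {Φ : ℝ → C(State X, State X)}

/-- The homeomorphisms of a flow. -/
def IsStateFlow.homeo (hΦ : IsStateFlow G Φ) (t : ℝ) : State X ≃ₜ State X where
  toFun := Φ t
  invFun := Φ (-t)
  left_inv ρ := by
    rw [← ContinuousMap.comp_apply, ← hΦ.add, add_neg_cancel, hΦ.zero]; rfl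
  right_inv ρ := by
    rw [← ContinuousMap.comp_apply, ← hΦ.add, neg_add_cancel, hΦ.zero]; rfl
  continuous_toFun := (Φ t).continuous
  continuous_invFun := (Φ (-t)).continuous

theorem classicalGroup_apply_apply (ϖ : ℝ → ℝ → State X ≃ₜ State X) (t : ℝ) (f : C(State X, ℂ))
    (ρ : State X) : classicalGroup ϖ t f ρ = f (ϖ 0 t ρ) := rfl

theorem IsStateFlow.classicalGroup_apply (hΦ : IsStateFlow G Φ) (t : ℝ) (f : C(State X, ℂ)) :
    classicalGroup (fun s t => hΦ.homeo (t - s)) t f = f.comp (Φ t) := by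
  ext ρ
  rw [classicalGroup_apply_apply, sub_zero]
  rfl

theorem IsStateFlow.isC0Group (hΦ : IsStateFlow G Φ) :
    IsC0Group (classicalGroup (fun s t => hΦ.homeo (t - s))) where
  zero := by
    ext1 f
    rw [hΦ.classicalGroup_apply, hΦ.zero]
    rfl
  add s t := by
    ext1 f
    rw [ContinuousLinearMap.comp_apply]
    simp only [hΦ.classicalGroup_apply]
    rw [hΦ.add]
    rfl
  continuous_apply f := by
    simp only [hΦ.classicalGroup_apply]
    exact (ContinuousMap.continuous_postcomp f).comp hΦ.continuous

theorem norm_classicalGroup_le (ϖ : ℝ → ℝ → State X ≃ₜ State X) (t : ℝ) (f : C(State X, ℂ)) :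
    ‖classicalGroup ϖ t f‖ ≤ ‖f‖ := by
  rw [ContinuousMap.norm_le _ (norm_nonneg _)]
  exact fun ρ => f.norm_coe_le_norm _

/-- Taking the operator as a restriction of the generator makes linearity automatic; only the
formula on polynomials has to be checked. -/
theorem IsStateFlow.exists_isPoissonianDerivation {h : C(State X, ℝ)} (hΦ : IsStateFlow G Φ)
    (hG : ∀ ρ, G ρ = stateGradient (complexify h) ρ) :
    ∃ d : C(State X, ℂ) →ₗ.[ℂ] C(State X, ℂ), IsPoissonianDerivation h d ∧
      d ≤ generator (classicalGroup (fun s t => hΦ.homeo (t - s))) := by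
  set V := classicalGroup (fun s t => hΦ.homeo (t - s)) with hV
  have key : ∀ f ∈ polynomials (Set.univ : Set X), ∃ W, HasGradient f W ∧
      ∃ hf : f ∈ (generator V).domain, generator V ⟨f, hf⟩ = pairing G W := by
    intro f hf
    obtain ⟨W, h1, h2⟩ := hΦ.exists_hasGradient hf
    refine ⟨W, h1, exists_generator_eq ?_⟩
    simpa only [hV, hΦ.classicalGroup_apply] using h2
  have hdom : Subalgebra.toSubmodule (polynomials (Set.univ : Set X)) ≤ (generator V).domain := by
    intro f hf
    obtain ⟨W, -, hf', -⟩ := key f hf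
    exact hf'
  refine ⟨(generator V).domRestrict (Subalgebra.toSubmodule (polynomials (Set.univ : Set X))),
    ⟨inf_eq_left.mpr hdom, fun f ρ => ?_⟩, LinearPMap.domRestrict_le⟩
  obtain ⟨W, h1, hf', e⟩ := key f f.2.1
  have e' : (generator V).domRestrict (Subalgebra.toSubmodule (polynomials (Set.univ : Set X))) f =
      pairing G W := (LinearPMap.domRestrict_apply (x := f) (y := ⟨f, hf'⟩) rfl).trans e
  rw [e', pairing_apply, bracket,
    (h1 ρ).stateGradient_eq, ← hG ρ]
  rfl

theorem IsStateFlow.isSelfConsistentFlow {h : C(State X, ℝ)} (hΦ : IsStateFlow G Φ)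
    (hG : ∀ ρ, G ρ = stateGradient (complexify h) ρ) :
    IsSelfConsistentFlow h fun s t => hΦ.homeo (t - s) := by
  constructor
  · have : Continuous fun p : ℝ × ℝ => Φ (p.2 - p.1) := hΦ.continuous.comp (by fun_prop)
    exact this
  · intro s ρ
    choose W hW0 hWΦ hWd using hΦ.exists_evolution
    -- The evolution started at time r is the one of the state Φ_{r-s}(ρ) reached at that time, run
    -- for the duration t - r.
    refine ⟨fun t r => W (Φ (r - s) ρ) (t - r), fun r => ⟨?_, fun t => ?_⟩, fun t A => ?_⟩
    · simp only [sub_self, hW0]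
    · have h1 := (hWd (Φ (r - s) ρ) (t - r)).comp_sub_const t r
      refine h1.congr_deriv ?_
      have h2 : Φ (t - r) (Φ (r - s) ρ) = Φ (t - s) ρ := by
        rw [← ContinuousMap.comp_apply, ← hΦ.add]
        congr 2
        ring
      rw [h2, hG]
      rfl
    · have h3 := hWΦ ρ (t - s) A
      simp only [sub_self, hΦ.zero]
      exact h3

theorem IsSelfConsistentFlow.isStateCurve {h : C(State X, ℝ)} {ϖ : ℝ → ℝ → State X ≃ₜ State X}
    (hϖ : IsSelfConsistentFlow h ϖ) (s : ℝ) (ρ : State X) :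
    IsStateCurve (stateGradient (complexify h)) (fun t => ϖ s t ρ) ∧ ϖ s s ρ = ρ := by
  obtain ⟨T, hT, hϖT⟩ := hϖ.2 s ρ
  refine ⟨fun A t => ?_, state_ext fun A => ?_⟩
  · have h1 := ((ContinuousLinearMap.apply ℂ X A).restrictScalars ℝ).hasFDerivAt.comp_hasDerivAt t
      ((hT s).2 t)
    have h2 := (ρ.toDual.restrictScalars ℝ).hasFDerivAt.comp_hasDerivAt t h1
    have e : (fun t => (ϖ s t ρ).1 A) = fun t => ρ.toDual (T t s A) := funext fun t => hϖT t A
    rw [e, hϖT t]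
    exact h2
  · rw [hϖT, (hT s).1]
    rfl

theorem IsStateFlow.eq_of_isSelfConsistentFlow {h : C(State X, ℝ)} (hΦ : IsStateFlow G Φ)
    (hG : ∀ ρ, G ρ = stateGradient (complexify h) ρ) {D M : ℝ} (hGL : IsLipschitzField G D M)
    {ϖ : ℝ → ℝ → State X ≃ₜ State X} (hϖ : IsSelfConsistentFlow h ϖ) :
    ϖ = fun s t => hΦ.homeo (t - s) := by
  have hG' : stateGradient (complexify h) = G := funext fun ρ => (hG ρ).symm
  funext s t
  ext1 ρ
  obtain ⟨h1, h2⟩ := hϖ.isStateCurve s ρ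
  rw [hG'] at h1
  have := IsStateCurve.unique hGL h1 ((hΦ.isStateCurve ρ).comp_add_const (-s)) (t₀ := s)
    (by simp [h2, hΦ.zero])
  exact congrFun this t

end Dynamics

/-! ### Groups of isometries of `C(E; ℂ)` with a conservative generator -/

section Dirac

variable {E : Type*} [TopologicalSpace E]

/-- A real function, as a complex one. -/
def ofRealMap : C(E, ℝ) →ₗ[ℝ] C(E, ℂ) where
  toFun f := ⟨fun x => (f x : ℂ), Complex.continuous_ofReal.comp f.continuous⟩
  map_add' f g := by ext x; simp
  map_smul' c f := by ext x; simp

theorem ofRealMap_apply (f : C(E, ℝ)) (x : E) : ofRealMap f x = (f x : ℂ) := rfl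

theorem isSelfAdjoint_ofRealMap (f : C(E, ℝ)) : IsSelfAdjoint (ofRealMap f) := by
  ext x
  exact Complex.conj_ofReal _

variable [CompactSpace E]

/-- Otherwise each x has some f_x with ℓ(f_x) ≠ f_x(x). Then |f_x - ℓ(f_x)| is positive near x,
while ℓ vanishes on it. By compactness a finite sum k of these is positive everywhere with ℓ(k) = 0,
contradicting ℓ(k) ≥ min k > 0. -/
theorem exists_forall_apply_eq_of_abs [Nonempty E] (ℓ : C(E, ℝ) →ₗ[ℝ] ℝ)
    (hpos : ∀ f, 0 ≤ f → 0 ≤ ℓ f)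
    (h1 : ℓ 1 = 1) (habs : ∀ f, ℓ |f| = |ℓ f|) : ∃ x, ∀ f, ℓ f = f x := by
  by_contra! hcon
  choose f hf using hcon
  let g : E → C(E, ℝ) := fun x => |f x - ℓ (f x) • 1|
  have hg0 : ∀ x y, 0 ≤ g x y := fun x y => abs_nonneg _
  have hgx : ∀ x, 0 < g x x := fun x => by
    have : f x x - ℓ (f x) * 1 ≠ 0 := by
      rw [mul_one]; exact sub_ne_zero.mpr (hf x).symm
    exact abs_pos.mpr this
  have hℓg : ∀ x, ℓ (g x) = 0 := fun x => by
    simp only [g]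
    rw [habs, map_sub, map_smul, h1, smul_eq_mul, mul_one, sub_self, abs_zero]
  obtain ⟨t, ht⟩ := CompactSpace.elim_nhds_subcover (fun x => {y | 0 < g x y}) fun x =>
    (isOpen_lt continuous_const (g x).continuous).mem_nhds (hgx x)
  let k : C(E, ℝ) := ∑ x ∈ t, g x
  have hk : ∀ y, 0 < k y := fun y => by
    have hy : y ∈ ⋃ x ∈ t, {y | 0 < g x y} := ht ▸ trivial
    simp only [Set.mem_iUnion] at hy
    obtain ⟨x, hx, hxy⟩ := hy
    simp only [k, ContinuousMap.sum_apply]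
    exact Finset.sum_pos' (fun z _ => hg0 z y) ⟨x, hx, hxy⟩
  have hℓk : ℓ k = 0 := by
    simp only [k, map_sum, hℓg, Finset.sum_const_zero]
  obtain ⟨m, -, hm⟩ := isCompact_univ.exists_isMinOn Set.univ_nonempty k.continuous.continuousOn
  have h2 : 0 ≤ ℓ (k - k m • 1) := hpos _ fun y => by
    have : k m ≤ k y := hm (Set.mem_univ y)
    change 0 ≤ k y - k m * 1
    linarith
  rw [map_sub, map_smul, h1, hℓk, smul_eq_mul, mul_one] at h2
  linarith [hk m]

/-- The action of `T` on real functions. -/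
def realAction (T : C(E, ℂ) →L[ℂ] C(E, ℂ)) : C(E, ℝ) →ₗ[ℝ] C(E, ℝ) where
  toFun f := ⟨fun x => (T (ofRealMap f) x).re,
    Complex.continuous_re.comp (T (ofRealMap f)).continuous⟩
  map_add' f g := by ext x; simp
  map_smul' c f := by
    ext x
    have : ofRealMap (c • f) = (c : ℂ) • ofRealMap f := by
      rw [map_smul]; ext x; simp
    simp [this]

variable {T S : C(E, ℂ) →L[ℂ] C(E, ℂ)}

theorem realAction_apply (f : C(E, ℝ)) (x : E) :
    realAction T f x = (T (ofRealMap f) x).re := rfl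

theorem norm_eval_comp_le (hT : ∀ f, ‖T f‖ ≤ ‖f‖) (x : E) (f : C(E, ℂ)) :
    ‖((ContinuousMap.evalCLM ℂ x).comp T) f‖ ≤ ‖f‖ :=
  ((T f).norm_coe_le_norm x).trans (hT f)

theorem ofRealMap_realAction (hT : ∀ f, ‖T f‖ ≤ ‖f‖) (hT1 : T 1 = 1) (f : C(E, ℝ)) :
    ofRealMap (realAction T f) = T (ofRealMap f) := by
  ext x
  have h1 : ((ContinuousMap.evalCLM ℂ x).comp T) 1 = 1 := by
    change T 1 x = 1
    rw [hT1]; rfl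
  have := im_eq_zero_of_norm_le ((ContinuousMap.evalCLM ℂ x).comp T) (norm_eval_comp_le hT x)
    h1 (isSelfAdjoint_ofRealMap f)
  exact Complex.ext rfl this.symm

theorem realAction_nonneg (hT : ∀ f, ‖T f‖ ≤ ‖f‖) (hT1 : T 1 = 1) {f : C(E, ℝ)} (hf : 0 ≤ f) :
    0 ≤ realAction T f := by
  intro x
  have h1 : ((ContinuousMap.evalCLM ℂ x).comp T) 1 = 1 := by
    change T 1 x = 1
    rw [hT1]; rfl
  let r : C(E, ℝ) := ⟨fun x => √(f x), f.continuous.sqrt⟩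
  have hr : star (ofRealMap r) * ofRealMap r = ofRealMap f := by
    rw [(isSelfAdjoint_ofRealMap r).star_eq]
    ext x
    change ((√(f x) : ℝ) : ℂ) * ((√(f x) : ℝ) : ℂ) = (f x : ℂ)
    rw [← Complex.ofReal_mul]
    exact congrArg _ (Real.mul_self_sqrt (hf x))
  have := star_mul_self_nonneg_of_norm_le ((ContinuousMap.evalCLM ℂ x).comp T)
    (norm_eval_comp_le hT x) h1 (ofRealMap r)
  rw [hr, Complex.le_def] at this
  exact this.1

theorem realAction_mono (hT : ∀ f, ‖T f‖ ≤ ‖f‖) (hT1 : T 1 = 1) {f g : C(E, ℝ)} (hfg : f ≤ g) :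
    realAction T f ≤ realAction T g := by
  rw [← sub_nonneg, ← map_sub]
  exact realAction_nonneg hT hT1 (sub_nonneg.mpr hfg)

theorem abs_realAction_le (hT : ∀ f, ‖T f‖ ≤ ‖f‖) (hT1 : T 1 = 1) (f : C(E, ℝ)) :
    |realAction T f| ≤ realAction T |f| := by
  refine abs_le'.mpr ⟨realAction_mono hT hT1 (le_abs_self f), ?_⟩
  rw [← map_neg]
  exact realAction_mono hT hT1 (neg_le_abs f)

/-- A unital isometry of `C(E; ℂ)` onto itself is a composition operator. -/
theorem exists_apply_eq_of_isometry (hT : ∀ f, ‖T f‖ ≤ ‖f‖) (hS : ∀ f, ‖S f‖ ≤ ‖f‖)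
    (hT1 : T 1 = 1) (hS1 : S 1 = 1) (hTS : ∀ f, T (S f) = f) (hST : ∀ f, S (T f) = f) (x : E) :
    ∃ y, ∀ f, T f x = f y := by
  have : Nonempty E := ⟨x⟩
  have e1 : ∀ f, realAction S (realAction T f) = f := fun f => by
    ext y
    rw [realAction_apply, ofRealMap_realAction hT hT1, hST]; rfl
  have e2 : ∀ f, realAction T (realAction S f) = f := fun f => by
    ext y
    rw [realAction_apply, ofRealMap_realAction hS hS1, hTS]; rfl
  -- Positivity gives |T f| ≤ T|f|. The same inequality for the inverse S, taken at T f and mapped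
  -- back by T, is the converse.
  have habs : ∀ f, realAction T |f| = |realAction T f| := fun f => by
    refine le_antisymm ?_ (abs_realAction_le hT hT1 f)
    have h1 := abs_realAction_le hS hS1 (realAction T f)
    rw [e1] at h1
    have h2 := realAction_mono hT hT1 h1
    rwa [e2] at h2
  let ℓ : C(E, ℝ) →ₗ[ℝ] ℝ := (ContinuousMap.evalCLM ℝ x).toLinearMap ∘ₗ realAction T
  obtain ⟨y, hy⟩ := exists_forall_apply_eq_of_abs ℓ
    (fun f hf => realAction_nonneg hT hT1 hf x)
    (by
      have : ofRealMap (1 : C(E, ℝ)) = 1 := by ext y; simp [ofRealMap_apply]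
      change (T (ofRealMap 1) x).re = 1
      rw [this, hT1]
      rfl)
    (fun f => DFunLike.congr_fun (habs f) x)
  have hreal : ∀ f : C(E, ℝ), T (ofRealMap f) x = (f y : ℂ) := fun f => by
    rw [← ofRealMap_realAction hT hT1, ofRealMap_apply]
    exact congrArg _ (hy f)
  refine ⟨y, fun f => ?_⟩
  let fr : C(E, ℝ) := ⟨fun x => (f x).re, Complex.continuous_re.comp f.continuous⟩
  let fi : C(E, ℝ) := ⟨fun x => (f x).im, Complex.continuous_im.comp f.continuous⟩
  have hf : f = ofRealMap fr + Complex.I • ofRealMap fi := by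
    ext z
    change f z = ((f z).re : ℂ) + Complex.I * ((f z).im : ℂ)
    rw [mul_comm, Complex.re_add_im]
  have h3 : T f x = T (ofRealMap fr) x + Complex.I * T (ofRealMap fi) x := by
    conv_lhs => rw [hf]
    rw [map_add, map_smul]
    rfl
  rw [h3, hreal, hreal, mul_comm]
  exact Complex.re_add_im _

end Dirac

/-- Conservativity makes U isometric on polynomials, hence contractive everywhere by density. Since
U fixes 1, each U_t evaluates functions at a point c_ρ(t), and differentiating U_t Â identifies c_ρ
as an integral curve. -/
theorem IsStateFlow.apply_eq_comp_of_isConservative {G : C(State X, X)}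
    {Φ : ℝ → C(State X, State X)} (hΦ : IsStateFlow G Φ) {D M : ℝ} (hG : IsLipschitzField G D M)
    {U : ℝ → C(State X, ℂ) →L[ℂ] C(State X, ℂ)} (hU : IsC0Group U)
    (hL : IsConservative (generator U))
    (hagree : ∀ f ∈ polynomials (Set.univ : Set X), ∀ y,
      HasDerivAt (fun t => f.comp (Φ t)) y 0 → HasDerivAt (fun t => U t f) y 0)
    (t : ℝ) (f : C(State X, ℂ)) : U t f = f.comp (Φ t) := by
  have hn : ∀ t f, ‖U t f‖ ≤ ‖f‖ := by
    intro t f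
    have hcl : IsClosed {f : C(State X, ℂ) | ‖U t f‖ ≤ ‖f‖} :=
      isClosed_le (U t).continuous.norm continuous_norm
    refine hcl.closure_subset_iff.mpr ?_ (dense_polynomials f)
    intro g hg
    obtain ⟨W, -, h2⟩ := hΦ.exists_hasGradient hg
    obtain ⟨hx, -⟩ := exists_generator_eq (hagree g hg _ h2)
    exact (hU.norm_apply_of_isConservative hL ⟨g, hx⟩ t).le
  have hd : ∀ g ∈ polynomials (Set.univ : Set X), ∀ y,
      HasDerivAt (fun t => g.comp (Φ t)) y 0 → ∀ t, HasDerivAt (fun t => U t g) (U t y) t := by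
    intro g hg y hy t
    obtain ⟨hx, e⟩ := exists_generator_eq (hagree g hg _ hy)
    rw [← e]
    exact hU.hasDerivAt ⟨g, hx⟩ t
  have h0 : ∀ f, U 0 f = f := fun f => by rw [hU.zero]; rfl
  have hone : ∀ t, U t 1 = 1 := by
    intro t
    have h1 : ∀ t, HasDerivAt (fun t => U t 1) 0 t := fun t => by
      have := hd 1 (one_mem _) 0 (hasDerivAt_const 0 (1 : C(State X, ℂ))) t
      rwa [map_zero] at this
    have := is_const_of_deriv_eq_zero (fun t => (h1 t).differentiableAt)
      (fun t => (h1 t).deriv) t 0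
    rwa [h0] at this
  have hcomp : ∀ t f, U t (U (-t) f) = f := fun t f => by
    rw [← ContinuousLinearMap.comp_apply, ← hU.add, add_neg_cancel, h0]
  have hcomp' : ∀ t f, U (-t) (U t f) = f := fun t f => by
    rw [← ContinuousLinearMap.comp_apply, ← hU.add, neg_add_cancel, h0]
  choose c hc using fun ρ t =>
    exists_apply_eq_of_isometry (hn t) (hn (-t)) (hone t) (hone (-t)) (hcomp t) (hcomp' t) ρ
  ext ρ
  have hcurve : IsStateCurve G (c ρ) := by
    intro A t
    have h1 := hd (hat A) (Algebra.subset_adjoin ⟨A, trivial, rfl⟩) _ (hΦ.hasDerivAt_hat A) t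
    have h2 := ((ContinuousMap.evalCLM ℝ ρ).hasFDerivAt.comp_hasDerivAt t h1 :)
    have e : (fun t => (c ρ t).1 A) = fun t => ContinuousMap.evalCLM ℝ ρ (U t (hat A)) :=
      funext fun t => (hc ρ t (hat A)).symm
    rw [e]
    refine h2.congr_deriv ?_
    exact hc ρ t _
  have hc0 : c ρ 0 = ρ := state_ext fun A => by
    have := hc ρ 0 (hat A)
    rw [h0] at this
    exact this.symm
  have := hcurve.unique hG (hΦ.isStateCurve ρ) (t₀ := 0) (by simp [hc0, hΦ.zero])
  rw [hc ρ t f, congrFun this t]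
  rfl

/-! ### Polynomial Hamiltonians -/

section Core

variable {F : Type*} [NormedAddCommGroup F] [NormedSpace ℂ F]

theorem dense_of_forall_dual (S : Submodule ℂ F)
    (h : ∀ φ : StrongDual ℂ F, (∀ x ∈ S, φ x = 0) → φ = 0) : Dense (S : Set F) := by
  intro x
  by_contra hx
  have hconv : Convex ℝ (closure (S : Set F)) := (S.restrictScalars ℝ).convex.closure
  obtain ⟨φ, u, hu, hux⟩ :=
    RCLike.geometric_hahn_banach_closed_point (𝕜 := ℂ) hconv isClosed_closure hx
  have h0 : φ = 0 := by
    refine h φ fun a ha => ?_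
    by_contra hne
    -- The multiple of a on which φ takes the value u, although Re φ < u on the closure.
    have h1 := hu (((u / Complex.normSq (φ a) : ℝ) * star (φ a) : ℂ) • a)
      (subset_closure (S.smul_mem _ ha))
    have h2 : Complex.normSq (φ a) ≠ 0 := fun h => hne (Complex.normSq_eq_zero.mp h)
    rw [map_smul, smul_eq_mul, mul_assoc, RCLike.star_def, mul_comm (starRingEnd ℂ _),
      Complex.mul_conj, ← Complex.ofReal_mul, div_mul_cancel₀ _ h2] at h1
    exact lt_irrefl _ h1
  have h1 := hu 0 (subset_closure S.zero_mem)
  rw [h0] at h1 hux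
  simp only [_root_.zero_apply, map_zero] at h1 hux
  exact lt_irrefl _ (h1.trans hux)

/-- A dissipative operator `L` is contained in the closure of a restriction `d` of it, if `1 - d`
has a dense range. -/
theorem IsDissipative.le_closure_of_dense {L d : F →ₗ.[ℂ] F} (hL : IsDissipative L) (hd : d ≤ L)
    (hcl : d.IsClosable)
    (hdense : ∀ y : F, y ∈ closure (Set.range fun x : d.domain => (x : F) - d x)) :
    L ≤ d.closure := by
  refine LinearPMap.le_of_le_graph ?_
  rw [← hcl.graph_closure_eq_closure_graph]
  rintro ⟨x, y⟩ hxy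
  obtain ⟨z, hz1, hz2⟩ := (LinearPMap.mem_graph_iff _).mp hxy
  change (z : F) = x at hz1
  change L z = y at hz2
  obtain ⟨p, hp, hlim⟩ := mem_closure_iff_seq_limit.mp (hdense (x - y))
  choose g hg using hp
  replace hg : ∀ n, (g n : F) - d (g n) = p n := hg
  have hLg : ∀ n, L ⟨g n, hd.1 (g n).2⟩ = d (g n) := fun n =>
    (hd.2 (x := g n) (y := ⟨g n, hd.1 (g n).2⟩) rfl).symm
  -- Dissipativity at l = 1 makes 1 - L expansive, so convergence of (1 - d) gₙ to (1 - L) x forces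
  -- gₙ → x.
  have hle : ∀ n, ‖(g n : F) - x‖ ≤ ‖p n - (x - y)‖ := by
    intro n
    have := hL.norm_le (⟨g n, hd.1 (g n).2⟩ - z) one_pos
    rw [LinearPMap.map_sub, hLg, hz2, one_smul] at this
    simp only [Submodule.coe_sub, hz1] at this
    refine this.trans (le_of_eq ?_)
    rw [← hg n]
    congr 1
    abel
  have h1 : Tendsto (fun n => (g n : F)) atTop (𝓝 x) := by
    rw [tendsto_iff_norm_sub_tendsto_zero]
    exact squeeze_zero (fun _ => norm_nonneg _) hle (tendsto_iff_norm_sub_tendsto_zero.mp hlim)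
  have h2 : Tendsto (fun n => d (g n)) atTop (𝓝 y) := by
    have := h1.sub hlim
    rw [sub_sub_cancel] at this
    refine this.congr fun n => ?_
    rw [← hg n, sub_sub_cancel]
  exact mem_closure_of_tendsto (h1.prodMk_nhds h2)
    (Eventually.of_forall fun n => d.mem_graph (g n))

end Core

/-! ### Uniqueness for chains of derivatives with factorial bounds -/

section Analytic

open scoped Nat

variable {H : ℕ → ℝ → ℂ} {K R T : ℝ}

/-- A Taylor estimate at s: the bound on the derivative of order k + n is integrated n times, with
zero initial values. -/
theorem norm_le_of_hasDerivAt_chain (hH : ∀ n t, HasDerivAt (H n) (H (n + 1) t) t)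
    (hb : ∀ n, ∀ t ∈ Set.Icc 0 T, ‖H n t‖ ≤ K * (n ! * R ^ n)) {s : ℝ}
    (hs0 : 0 ≤ s) (hs : ∀ n, H n s = 0) (n : ℕ) : ∀ k, ∀ t ∈ Set.Icc s T,
      ‖H k t‖ ≤ K * ((k + n) ! * R ^ (k + n)) * ((t - s) ^ n / n !) := by
  induction n with
  | zero =>
    intro k t ht
    simpa using hb k t ⟨hs0.trans ht.1, ht.2⟩
  | succ n ih =>
    intro k t ht
    set a := K * ((k + (n + 1)) ! * R ^ (k + (n + 1))) with ha
    have hB : ∀ x : ℝ, HasDerivAt (fun x => a * ((x - s) ^ (n + 1) / (n + 1) !))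
        (a * ((x - s) ^ n / n !)) x := by
      intro x
      have h1 := ((((hasDerivAt_id x).sub_const s).pow (n + 1)).div_const
        ((n + 1) ! : ℝ)).const_mul a
      refine h1.congr_deriv ?_
      have h2 : (n ! : ℝ) ≠ 0 := by positivity
      have h3 : (n : ℝ) + 1 ≠ 0 := by positivity
      rw [Nat.factorial_succ]
      simp only [id, add_tsub_cancel_right]
      push_cast
      field_simp
    refine image_norm_le_of_norm_deriv_right_le_deriv_boundary (f := H k) (a := s) (b := t)
      (fun x _ => (hH k x).continuousAt.continuousWithinAt)
      (fun x _ => (hH k x).hasDerivWithinAt) ?_ hB ?_ (Set.right_mem_Icc.mpr ht.1)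
    · rw [hs]; simp
    · intro x hx
      have := ih (k + 1) x ⟨hx.1, hx.2.le.trans ht.2⟩
      rwa [show k + 1 + n = k + (n + 1) by ring] at this

theorem factorial_add_le (k n : ℕ) : ((k + n) ! : ℝ) ≤ 2 ^ (k + n) * (k ! * n !) := by
  have h1 : (k + n) ! = (k + n).choose n * k ! * n ! :=
    (Nat.add_choose_mul_factorial_mul_factorial k n).symm
  have h2 : (k + n) ! ≤ 2 ^ (k + n) * (k ! * n !) := by
    rw [h1, mul_assoc]
    exact Nat.mul_le_mul_right _ (Nat.choose_le_two_pow _ _)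
  exact_mod_cast h2

/-- With (k+n)! ≤ 2^(k+n) k! n!, the Taylor estimate decays like (2R(t-s))ⁿ ≤ 2⁻ⁿ as long as 4R(t-s)
≤ 1. The step 1/(4R) does not depend on s, so finitely many steps cover [0, T]. -/
theorem eq_zero_of_hasDerivAt_chain (hR : 0 < R) (hK : 0 ≤ K)
    (hH : ∀ n t, HasDerivAt (H n) (H (n + 1) t) t)
    (hb : ∀ n, ∀ t ∈ Set.Icc 0 T, ‖H n t‖ ≤ K * (n ! * R ^ n)) (h0 : ∀ n, H n 0 = 0)
    {t : ℝ} (ht : t ∈ Set.Icc 0 T) : H 0 t = 0 := by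
  have step : ∀ s : ℝ, 0 ≤ s → (∀ n, H n s = 0) → ∀ t ∈ Set.Icc s T, 4 * R * (t - s) ≤ 1 →
      ∀ k, H k t = 0 := by
    intro s hs0 hs t ht hts k
    have h1 : ∀ n : ℕ, ‖H k t‖ ≤ K * (k ! * (2 * R) ^ k) * (1 / 2) ^ n := by
      intro n
      refine (norm_le_of_hasDerivAt_chain hH hb hs0 hs n k t ht).trans ?_
      have hts0 : 0 ≤ t - s := sub_nonneg.mpr ht.1
      calc K * ((k + n) ! * R ^ (k + n)) * ((t - s) ^ n / n !)
          ≤ K * (2 ^ (k + n) * (k ! * n !) * R ^ (k + n)) * ((t - s) ^ n / n !) := by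
            gcongr
            exact factorial_add_le k n
        _ = K * (k ! * (2 * R) ^ k) * (2 * R * (t - s)) ^ n := by
            have h2 : (n ! : ℝ) ≠ 0 := by positivity
            rw [pow_add, pow_add, mul_pow, mul_pow, mul_pow]
            field_simp
        _ ≤ K * (k ! * (2 * R) ^ k) * (1 / 2) ^ n := by
            gcongr
            linarith
    have h2 : Tendsto (fun n : ℕ => K * (k ! * (2 * R) ^ k) * (1 / 2 : ℝ) ^ n) atTop (𝓝 0) := by
      have := (tendsto_pow_atTop_nhds_zero_of_lt_one (r := (1 / 2 : ℝ)) (by norm_num)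
        (by norm_num)).const_mul (K * (k ! * (2 * R) ^ k))
      simpa using this
    exact norm_le_zero_iff.mp (ge_of_tendsto' h2 h1)
  have main : ∀ j : ℕ, ∀ t ∈ Set.Icc 0 T, 4 * R * t ≤ j → ∀ k, H k t = 0 := by
    intro j
    induction j with
    | zero =>
      intro t ht htj k
      have : t = 0 := by
        push_cast at htj
        nlinarith [ht.1]
      rw [this, h0]
    | succ j ih =>
      intro t ht htj k
      push_cast at htj
      by_cases hj : 4 * R * t ≤ j
      · exact ih t ht hj k
      · push Not at hj
        have hpos : 0 < 4 * R := by positivity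
        have e : 4 * R * ((j : ℝ) / (4 * R)) = j := by field_simp
        have hs0 : 0 ≤ (j : ℝ) / (4 * R) := by positivity
        have hst : (j : ℝ) / (4 * R) ≤ t := by
          rw [div_le_iff₀ hpos]; linarith
        refine step _ hs0 (ih _ ⟨hs0, hst.trans ht.2⟩ e.le) t ⟨hst, ht.2⟩ ?_ k
        rw [mul_sub, e]
        linarith
  obtain ⟨j, hj⟩ := exists_nat_ge (4 * R * t)
  exact main j t ht hj 0

end Analytic

/-- `f` is a sum of products of at most `m` functions `Â`, with total weight at most `c`. -/
inductive HasWeight : ℕ → ℝ → C(State X, ℂ) → Prop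
  | const (z : ℂ) : HasWeight 0 ‖z‖ (algebraMap ℂ C(State X, ℂ) z)
  | hat (A : X) : HasWeight 1 (2 * ‖A‖) (hat A)
  | add {m : ℕ} {c c' : ℝ} {f g : C(State X, ℂ)} :
      HasWeight m c f → HasWeight m c' g → HasWeight m (c + c') (f + g)
  | mul {m n : ℕ} {c c' : ℝ} {f g : C(State X, ℂ)} :
      HasWeight m c f → HasWeight n c' g → HasWeight (m + n) (c * c') (f * g)
  | mono {m m' : ℕ} {c c' : ℝ} {f : C(State X, ℂ)} :
      HasWeight m c f → m ≤ m' → c ≤ c' → HasWeight m' c' f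

theorem HasWeight.nonneg {m : ℕ} {c : ℝ} {f : C(State X, ℂ)} (h : HasWeight m c f) : 0 ≤ c := by
  induction h with
  | const z => positivity
  | hat A => positivity
  | add _ _ h1 h2 => positivity
  | mul _ _ h1 h2 => positivity
  | mono _ _ h2 h3 => exact h3.trans h2

theorem HasWeight.norm_le {m : ℕ} {c : ℝ} {f : C(State X, ℂ)} (h : HasWeight m c f) :
    ‖f‖ ≤ c := by
  induction h with
  | const z =>
    rw [ContinuousMap.norm_le _ (norm_nonneg z)]
    exact fun ρ => le_rfl
  | hat A =>
    rw [ContinuousMap.norm_le _ (by positivity)]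
    exact fun ρ => norm_apply_le ρ A
  | add _ _ h1 h2 => exact (norm_add_le _ _).trans (add_le_add h1 h2)
  | mul h h' h1 h2 =>
    exact (norm_mul_le _ _).trans (mul_le_mul h1 h2 (norm_nonneg _) h.nonneg)
  | mono _ _ h2 h3 => exact h3.trans h2

theorem HasWeight.mem_polynomials {m : ℕ} {c : ℝ} {f : C(State X, ℂ)} (h : HasWeight m c f) :
    f ∈ polynomials (Set.univ : Set X) := by
  induction h with
  | const z => exact Subalgebra.algebraMap_mem _ _
  | hat A => exact Algebra.subset_adjoin ⟨A, trivial, rfl⟩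
  | add _ _ h1 h2 => exact add_mem h1 h2
  | mul _ _ h1 h2 => exact mul_mem h1 h2
  | mono _ _ _ h => exact h

theorem exists_hasWeight {f : C(State X, ℂ)} (hf : f ∈ polynomials (Set.univ : Set X)) :
    ∃ m c, HasWeight m c f := by
  induction hf using Algebra.adjoin_induction with
  | mem f hf =>
    obtain ⟨A, -, rfl⟩ := hf
    exact ⟨_, _, .hat A⟩
  | algebraMap z => exact ⟨_, _, .const z⟩
  | add f g _ _ hf hg =>
    obtain ⟨m, c, h⟩ := hf
    obtain ⟨n, c', h'⟩ := hg
    exact ⟨max m n, _, (h.mono (le_max_left _ _) le_rfl).add (h'.mono (le_max_right _ _) le_rfl)⟩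
  | mul f g _ _ hf hg =>
    obtain ⟨m, c, h⟩ := hf
    obtain ⟨n, c', h'⟩ := hg
    exact ⟨_, _, h.mul h'⟩

theorem hasWeight_zero (m : ℕ) {c : ℝ} (hc : 0 ≤ c) : HasWeight m c (0 : C(State X, ℂ)) := by
  have := HasWeight.const (X := X) 0
  rw [map_zero, norm_zero] at this
  exact this.mono (Nat.zero_le m) hc

/-- `{f, ·}` raises the degree of the functions `Â` by a bounded amount, if `f` is a polynomial. -/
theorem exists_hasWeight_pairing {f : C(State X, ℂ)} (hf : f ∈ polynomials (Set.univ : Set X)) :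
    ∃ W, HasGradient f W ∧ ∃ (q : ℕ) (C : ℝ), 0 ≤ C ∧ ∀ A : X,
      HasWeight (1 + q) (C * (2 * ‖A‖)) (pairing W (ContinuousMap.const _ A)) := by
  induction hf using Algebra.adjoin_induction with
  | mem f hf =>
    obtain ⟨B, -, rfl⟩ := hf
    refine ⟨_, hasGradient_hat B, 0, 2 * ‖B‖, by positivity, fun A => ?_⟩
    have e : pairing (ContinuousMap.const _ B -
        ⟨fun ρ => ρ.1 B • (1 : X), (hat B).continuous.smul continuous_const⟩)
        (ContinuousMap.const _ A) = hat (commutator B A) := by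
      ext ρ
      change ρ.1 (commutator (B - ρ.1 B • (1 : X)) A) = ρ.1 (commutator B A)
      simp only [commutator_apply, sub_mul, mul_sub, smul_mul_assoc, mul_smul_comm, one_mul,
        mul_one]
      congr 2
      abel
    rw [e]
    refine (HasWeight.hat _).mono le_rfl ?_
    have := norm_commutator_le B A
    linarith
  | algebraMap z =>
    refine ⟨0, hasGradient_const z, 0, 0, le_rfl, fun A => ?_⟩
    have e : pairing (0 : C(State X, X)) (ContinuousMap.const _ A) = 0 := by
      ext ρ
      change ρ.1 (commutator 0 A) = 0
      simp [commutator_apply]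
    rw [e, zero_mul]
    exact hasWeight_zero _ le_rfl
  | add f g _ _ hf hg =>
    obtain ⟨W, hW, q, C, hC, h⟩ := hf
    obtain ⟨W', hW', q', C', hC', h'⟩ := hg
    refine ⟨_, hW.add hW', max q q', C + C', by positivity, fun A => ?_⟩
    have e : pairing (W + W') (ContinuousMap.const _ A) =
        pairing W (ContinuousMap.const _ A) + pairing W' (ContinuousMap.const _ A) := by
      ext ρ
      change ρ.1 (commutator (W ρ + W' ρ) A) =
        ρ.1 (commutator (W ρ) A) + ρ.1 (commutator (W' ρ) A)
      rw [← map_add]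
      simp only [commutator_apply, add_mul, mul_add, ← smul_add]
      congr 2
      abel
    rw [e, add_mul]
    exact ((h A).mono (by gcongr; exact le_max_left _ _) le_rfl).add
      ((h' A).mono (by gcongr; exact le_max_right _ _) le_rfl)
  | mul f g hf' hg' hf hg =>
    obtain ⟨W, hW, q, C, hC, h⟩ := hf
    obtain ⟨W', hW', q', C', hC', h'⟩ := hg
    obtain ⟨m, c, hm⟩ := exists_hasWeight hf'
    obtain ⟨n, c', hn⟩ := exists_hasWeight hg'
    have hc := hm.nonneg
    have hc' := hn.nonneg
    -- The degree shift is a crude common bound for m + q' and n + q, the shifts of the two Leibniz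
    -- terms.
    refine ⟨_, hW.mul hW', m + q' + (n + q), c * C' + c' * C, by positivity, fun A => ?_⟩
    have e : pairing (mulField f W' + mulField g W) (ContinuousMap.const _ A) =
        f * pairing W' (ContinuousMap.const _ A) + g * pairing W (ContinuousMap.const _ A) := by
      ext ρ
      change ρ.1 (commutator (f ρ • W' ρ + g ρ • W ρ) A) =
        f ρ * ρ.1 (commutator (W' ρ) A) + g ρ * ρ.1 (commutator (W ρ) A)
      rw [← smul_eq_mul, ← smul_eq_mul, ← map_smul ρ.1, ← map_smul ρ.1, ← map_add ρ.1]
      simp only [commutator_apply, add_mul, mul_add, smul_mul_assoc, mul_smul_comm, smul_sub,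
        smul_add, smul_comm Complex.I]
      congr 1
      abel
    rw [e, add_mul]
    exact ((hm.mul (h' A)).mono (by omega) (le_of_eq (by ring))).add
      ((hn.mul (h A)).mono (by omega) (le_of_eq (by ring)))

/-! ### Analytic vectors of a polynomial flow -/

section Analytic

open scoped Nat

variable {G : C(State X, X)} {Φ : ℝ → C(State X, State X)}

/-- The derivative of `f` along the flow. -/
def flowDeriv (Φ : ℝ → C(State X, State X)) (f : C(State X, ℂ)) : C(State X, ℂ) :=
  deriv (fun t => f.comp (Φ t)) 0

/-- By the Leibniz rule, each of at most m factors is replaced in turn, at cost C and with q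
additional factors. -/
theorem IsStateFlow.exists_hasDerivAt_hasWeight (hΦ : IsStateFlow G Φ) {q : ℕ} {C : ℝ}
    (hC : 0 ≤ C) (hG : ∀ A : X,
      HasWeight (1 + q) (C * (2 * ‖A‖)) (pairing G (ContinuousMap.const _ A)))
    {m : ℕ} {c : ℝ} {f : C(State X, ℂ)} (hf : HasWeight m c f) :
    ∃ y, HasDerivAt (fun t => f.comp (Φ t)) y 0 ∧ HasWeight (m + q) (m * C * c) y := by
  induction hf with
  | const z =>
    refine ⟨0, hasDerivAt_const 0 (algebraMap ℂ C(State X, ℂ) z), hasWeight_zero _ ?_⟩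
    simp
  | hat A =>
    refine ⟨_, hΦ.hasDerivAt_hat A, (hG A).mono le_rfl ?_⟩
    simp
  | add h h' hf hg =>
    obtain ⟨y, h1, h2⟩ := hf
    obtain ⟨y', h3, h4⟩ := hg
    refine ⟨y + y', h1.add h3, ?_⟩
    rw [mul_add]
    exact h2.add h4
  | @mul m n c c' f g h h' hf hg =>
    obtain ⟨y, h1, h2⟩ := hf
    obtain ⟨y', h3, h4⟩ := hg
    refine ⟨y * g + f * y', ?_, ?_⟩
    · have h5 : HasDerivAt (fun t => f.comp (Φ t) * g.comp (Φ t)) _ 0 := h1.mul h3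
      refine h5.congr_deriv ?_
      rw [hΦ.zero]
      rfl
    · refine (((h2.mul h').mono (m' := m + n + q) (by omega) le_rfl).add
        ((h.mul h4).mono (m' := m + n + q) (by omega) le_rfl)).mono le_rfl (le_of_eq ?_)
      push_cast
      ring
  | @mono m m' c c' f h h1 h2 hf =>
    obtain ⟨y, h3, h4⟩ := hf
    refine ⟨y, h3, h4.mono (by omega) ?_⟩
    have h5 : (m : ℝ) ≤ m' := by exact_mod_cast h1
    have := h.nonneg
    gcongr

/-- The successive degrees multiply to m(m+q)⋯(m+(n-1)q), which for q ≥ 1 is at most qⁿ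
m(m+1)⋯(m+n-1). -/
theorem IsStateFlow.hasWeight_iterate (hΦ : IsStateFlow G Φ) {q : ℕ} {C : ℝ} (hq : 1 ≤ q)
    (hC : 0 ≤ C) (hG : ∀ A : X,
      HasWeight (1 + q) (C * (2 * ‖A‖)) (pairing G (ContinuousMap.const _ A)))
    {m : ℕ} {c : ℝ} {f : C(State X, ℂ)} (hf : HasWeight m c f) (n : ℕ) :
    HasWeight (m + n * q) (c * (C * q) ^ n * m.ascFactorial n) ((flowDeriv Φ)^[n] f) := by
  induction n with
  | zero => simpa using hf
  | succ n ih =>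
    obtain ⟨y, h1, h2⟩ := hΦ.exists_hasDerivAt_hasWeight hC hG ih
    have e : flowDeriv Φ ((flowDeriv Φ)^[n] f) = y := h1.deriv
    rw [Function.iterate_succ_apply', e]
    refine h2.mono (le_of_eq (by ring)) ?_
    have h3 : ((m + n * q : ℕ) : ℝ) ≤ q * (m + n) := by
      have : m + n * q ≤ q * (m + n) := by nlinarith
      exact_mod_cast this
    have h4 := ih.nonneg
    rw [Nat.ascFactorial_succ]
    calc ((m + n * q : ℕ) : ℝ) * C * (c * (C * q) ^ n * m.ascFactorial n)
        ≤ q * (m + n) * C * (c * (C * q) ^ n * m.ascFactorial n) := by gcongr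
      _ = _ := by push_cast; ring

theorem ascFactorial_le (m n : ℕ) : (m.ascFactorial n : ℝ) ≤ 2 ^ (m + n) * n ! := by
  have h : m.ascFactorial n ≤ 2 ^ (m + n) * n ! := by
    rw [Nat.ascFactorial_eq_factorial_mul_choose', mul_comm]
    refine Nat.mul_le_mul_right _ ((Nat.choose_le_two_pow _ _).trans ?_)
    exact Nat.pow_le_pow_right two_pos (Nat.sub_le _ _)
  exact_mod_cast h

/-- Polynomials are analytic vectors of the flow of a polynomial. -/
theorem IsStateFlow.exists_norm_iterate_le (hΦ : IsStateFlow G Φ) {q : ℕ} {C : ℝ} (hq : 1 ≤ q)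
    (hC : 0 ≤ C) (hG : ∀ A : X,
      HasWeight (1 + q) (C * (2 * ‖A‖)) (pairing G (ContinuousMap.const _ A)))
    {f : C(State X, ℂ)} (hf : f ∈ polynomials (Set.univ : Set X)) :
    ∃ K, 0 ≤ K ∧ ∀ n, (flowDeriv Φ)^[n] f ∈ polynomials (Set.univ : Set X) ∧
      HasDerivAt (fun t => ((flowDeriv Φ)^[n] f).comp (Φ t)) ((flowDeriv Φ)^[n + 1] f) 0 ∧
      ‖(flowDeriv Φ)^[n] f‖ ≤ K * (n ! * (2 * C * q + 1) ^ n) := by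
  obtain ⟨m, c, hm⟩ := exists_hasWeight hf
  have hc := hm.nonneg
  refine ⟨c * 2 ^ m, by positivity, fun n => ?_⟩
  have h1 := hΦ.hasWeight_iterate hq hC hG hm n
  obtain ⟨y, h2, -⟩ := hΦ.exists_hasDerivAt_hasWeight hC hG h1
  refine ⟨h1.mem_polynomials, ?_, h1.norm_le.trans ?_⟩
  · have e : flowDeriv Φ ((flowDeriv Φ)^[n] f) = y := h2.deriv
    rw [Function.iterate_succ_apply', e]
    exact h2
  · calc c * (C * q) ^ n * m.ascFactorial n ≤ c * (C * q) ^ n * (2 ^ (m + n) * n !) := by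
          gcongr
          exact ascFactorial_le m n
      _ = c * 2 ^ m * (n ! * (2 * C * q) ^ n) := by
          rw [pow_add, mul_assoc 2 C, mul_pow 2]; ring
      _ ≤ _ := by
          gcongr
          linarith

/-- The equation y' = y for y(t) = ψ(V_t f) is not immediate, because V_t f need not be a
polynomial. At t = 0, however, all derivatives of y equal ψ(f), and analyticity propagates this to
y(t) = eᵗ ψ(f). -/
theorem IsStateFlow.dual_eq_zero (hΦ : IsStateFlow G Φ) {q : ℕ} {C : ℝ} (hq : 1 ≤ q)
    (hC : 0 ≤ C) (hG : ∀ A : X,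
      HasWeight (1 + q) (C * (2 * ‖A‖)) (pairing G (ContinuousMap.const _ A)))
    (ψ : StrongDual ℂ C(State X, ℂ))
    (hψ : ∀ f ∈ polynomials (Set.univ : Set X), ψ (f - flowDeriv Φ f) = 0) : ψ = 0 := by
  have hexp : ∀ f ∈ polynomials (Set.univ : Set X), ∀ t : ℝ, 0 ≤ t →
      ψ (f.comp (Φ t)) = Real.exp t * ψ f := by
    intro f hf t ht
    obtain ⟨K, hK, hiter⟩ := hΦ.exists_norm_iterate_le hq hC hG hf
    set g : ℕ → C(State X, ℂ) := fun n => (flowDeriv Φ)^[n] f with hg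
    have hψg : ∀ n, ψ (g n) = ψ f := by
      intro n
      induction n with
      | zero => rfl
      | succ n ih =>
        have := hψ (g n) (hiter n).1
        rw [map_sub, sub_eq_zero, ih] at this
        simp only [hg, Function.iterate_succ_apply']
        exact this.symm
    let H : ℕ → ℝ → ℂ := fun n t => ψ ((g n).comp (Φ t)) - Real.exp t * ψ f
    have hH : ∀ n t, HasDerivAt (H n) (H (n + 1) t) t := by
      intro n t
      have h1 : HasDerivAt (fun t => (g n).comp (Φ t)) ((g (n + 1)).comp (Φ t)) t := by
        have h2 := (hiter n).2.1
        obtain ⟨hx, e⟩ := exists_generator_eq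
          (U := classicalGroup (fun s t => hΦ.homeo (t - s))) (x := g n) (y := g (n + 1))
          (by simpa only [hΦ.classicalGroup_apply] using h2)
        have h3 := hΦ.isC0Group.hasDerivAt ⟨g n, hx⟩ t
        rw [e] at h3
        simpa only [hΦ.classicalGroup_apply] using h3
      have h2 := ((ψ.restrictScalars ℝ).hasFDerivAt.comp_hasDerivAt t h1 :)
      have h3 := (Real.hasDerivAt_exp t).ofReal_comp.mul_const (ψ f)
      exact h2.sub h3
    have hzero := eq_zero_of_hasDerivAt_chain (H := H) (T := t) (R := 2 * C * q + 1)
      (K := ‖ψ‖ * K + Real.exp t * ‖ψ f‖) (by positivity) (by positivity) hH ?_ ?_ (t := t)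
      ⟨ht, le_rfl⟩
    · exact sub_eq_zero.mp hzero
    · intro n r hr
      -- The summand 1 in the rate makes this factor at least 1, so the exponential term obeys a
      -- bound of the same shape.
      have hn : (1 : ℝ) ≤ n ! * (2 * C * q + 1) ^ n := by
        have h1 : (1 : ℝ) ≤ n ! := by exact_mod_cast Nat.one_le_iff_ne_zero.mpr n.factorial_ne_zero
        have h2 : (1 : ℝ) ≤ (2 * C * q + 1) ^ n := one_le_pow₀ (by
          have : 0 ≤ 2 * C * q := by positivity
          linarith)
        nlinarith
      refine (norm_sub_le _ _).trans ?_
      rw [add_mul]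
      refine add_le_add ?_ ?_
      · have h1 : ‖(g n).comp (Φ r)‖ ≤ ‖g n‖ := by
          rw [ContinuousMap.norm_le _ (norm_nonneg _)]
          exact fun ρ => (g n).norm_coe_le_norm _
        calc _ ≤ ‖ψ‖ * ‖(g n).comp (Φ r)‖ := ψ.le_opNorm _
          _ ≤ ‖ψ‖ * (K * (n ! * (2 * C * q + 1) ^ n)) := by
            gcongr
            exact h1.trans (hiter n).2.2
          _ = _ := by ring
      · rw [norm_mul, Complex.norm_real, Real.norm_of_nonneg (Real.exp_pos r).le]
        calc Real.exp r * ‖ψ f‖ ≤ Real.exp t * ‖ψ f‖ * 1 := by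
              rw [mul_one]
              gcongr
              exact hr.2
          _ ≤ _ := by gcongr
    · intro n
      simp only [H, hΦ.zero, Real.exp_zero, Complex.ofReal_one, one_mul]
      exact sub_eq_zero.mpr (hψg n)
  have hpoly : ∀ f ∈ polynomials (Set.univ : Set X), ψ f = 0 := by
    intro f hf
    by_contra hne
    have hpos : 0 < ‖ψ f‖ := norm_pos_iff.mpr hne
    -- For this t, eᵗ ≥ 1 + t gives eᵗ ‖ψ f‖ ≥ ‖ψ‖ ‖f‖ + ‖ψ f‖, exceeding the bound on ψ(f ∘ Φ_t).
    set t := ‖ψ‖ * ‖f‖ / ‖ψ f‖ with ht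
    have ht0 : 0 ≤ t := by positivity
    have h1 : Real.exp t * ‖ψ f‖ ≤ ‖ψ‖ * ‖f‖ := by
      have e : Real.exp t * ‖ψ f‖ = ‖ψ (f.comp (Φ t))‖ := by
        rw [hexp f hf t ht0, norm_mul, Complex.norm_real,
          Real.norm_of_nonneg (Real.exp_pos t).le]
      rw [e]
      refine (ψ.le_opNorm _).trans ?_
      gcongr
      rw [ContinuousMap.norm_le _ (norm_nonneg _)]
      exact fun ρ => f.norm_coe_le_norm _
    have h2 := Real.add_one_le_exp t
    have h3 : t * ‖ψ f‖ = ‖ψ‖ * ‖f‖ := by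
      rw [ht]; field_simp
    nlinarith
  ext f
  have hcl : IsClosed {f : C(State X, ℂ) | ψ f = 0} := isClosed_eq ψ.continuous continuous_const
  exact hcl.closure_subset_iff.mpr hpoly (dense_polynomials f)

end Analytic

theorem IsStateFlow.generator_le_closure {G : C(State X, X)} {Φ : ℝ → C(State X, State X)}
    (hΦ : IsStateFlow G Φ) {d : C(State X, ℂ) →ₗ.[ℂ] C(State X, ℂ)}
    (hdom : d.domain = Subalgebra.toSubmodule (polynomials (Set.univ : Set X)))
    (hle : d ≤ generator (classicalGroup (fun s t => hΦ.homeo (t - s))))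
    (hcl : d.IsClosable) {g : C(State X, ℂ)} (hg : g ∈ polynomials (Set.univ : Set X))
    (hgG : HasGradient g G) :
    generator (classicalGroup (fun s t => hΦ.homeo (t - s))) ≤ d.closure := by
  obtain ⟨W, hW, q, C, hC, hWt⟩ := exists_hasWeight_pairing hg
  obtain rfl : W = G := ContinuousMap.ext fun ρ => (hW ρ).hat_unique (hgG ρ)
  refine IsDissipative.le_closure_of_dense
    (hΦ.isC0Group.isConservative_generator (norm_classicalGroup_le _)).1 hle hcl ?_
  have hd : ∀ f : d.domain, d f = flowDeriv Φ f := by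
    intro f
    rw [hle.2 (x := f) (y := ⟨f, hle.1 f.2⟩) rfl]
    change deriv (fun t => classicalGroup (fun s t => hΦ.homeo (t - s)) t (f : C(State X, ℂ))) 0 = _
    simp only [hΦ.classicalGroup_apply]
    rfl
  refine dense_of_forall_dual (LinearMap.range (d.domain.subtype - d.toFun)) fun ψ hψ => ?_
  -- The shift is enlarged to 1 + q because the growth estimate needs it to be at least 1.
  refine hΦ.dual_eq_zero (q := 1 + q) (Nat.le_add_right 1 q) hC
    (fun A => (hWt A).mono (by omega) le_rfl) ψ fun f hf => ?_
  have hf' : f ∈ d.domain := hdom ▸ hf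
  refine hψ _ ⟨⟨f, hf'⟩, ?_⟩
  change f - d ⟨f, hf'⟩ = _
  rw [hd]

end StateFlow
end

open StateFlow
theorem mainTheorem2 {X : Type*} [CStarAlgebra X]
    (𝔅 : Submodule ℝ (selfAdjoint X)) [FiniteDimensional ℝ 𝔅]
    (h : C(State X, ℝ)) (hC1 : IsContDiff h) (D₀ : ℝ) (hD₀ : 0 < D₀)
    (hLip : ∀ ρ υ : State X,
      ‖stateGradient (complexify h) ρ - stateGradient (complexify h) υ‖ ≤
        D₀ * sSup {r : ℝ | ∃ B ∈ 𝔅, ‖B‖ = 1 ∧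
          r = ‖(ρ : WeakDual ℂ X) (B : X) - (υ : WeakDual ℂ X) (B : X)‖}) :
    ∃ ϖ : ℝ → ℝ → State X ≃ₜ State X,
      IsSelfConsistentFlow h ϖ ∧
      (∀ ϖ' : ℝ → ℝ → State X ≃ₜ State X, IsSelfConsistentFlow h ϖ' → ϖ' = ϖ) ∧
      IsC0Group (classicalGroup ϖ) ∧
      ∃ d : C(State X, ℂ) →ₗ.[ℂ] C(State X, ℂ),
        IsPoissonianDerivation h d ∧
        (d.IsClosable ∧ IsConservative d.closure ∧ d.closure ≤ generator (classicalGroup ϖ)) ∧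
        (∀ L : C(State X, ℂ) →ₗ.[ℂ] C(State X, ℂ),
          d.closure ≤ L → L.IsClosed → IsConservative L →
          (∃ U : ℝ → C(State X, ℂ) →L[ℂ] C(State X, ℂ), IsC0Group U ∧ L = generator U) →
          L = generator (classicalGroup ϖ)) ∧
        (complexify h ∈ polynomials {A : X | IsSelfAdjoint A} →
          d.closure = generator (classicalGroup ϖ)) := by
  obtain ⟨M, hG⟩ := exists_isLipschitzField 𝔅 h D₀ hD₀ hLip
  let G : C(State X, X) := ⟨stateGradient (complexify h), hG.continuous⟩
  have hGL : IsLipschitzField G D₀ M := hG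
  have hGh : ∀ ρ, G ρ = stateGradient (complexify h) ρ := fun _ => rfl
  obtain ⟨Φ, hΦ⟩ := exists_isStateFlow hGL
  obtain ⟨d, hd, hle⟩ := hΦ.exists_isPoissonianDerivation hGh
  have hVcl := hΦ.isC0Group.isClosed_generator (norm_classicalGroup_le _)
  have hVcons := hΦ.isC0Group.isConservative_generator (norm_classicalGroup_le _)
  have hcl : d.IsClosable := hVcl.isClosable.leIsClosable hle
  have hle' : d.closure ≤ generator (classicalGroup (fun s t => hΦ.homeo (t - s))) := by
    refine LinearPMap.le_of_le_graph ?_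
    rw [← hcl.graph_closure_eq_closure_graph]
    exact Submodule.topologicalClosure_minimal _ (LinearPMap.le_graph_of_le hle) hVcl
  refine ⟨fun s t => hΦ.homeo (t - s), hΦ.isSelfConsistentFlow hGh,
    fun ϖ' hϖ' => hΦ.eq_of_isSelfConsistentFlow hGh hGL hϖ', hΦ.isC0Group, d, hd,
    ⟨hcl, hVcons.mono hle', hle'⟩, ?_, ?_⟩
  · rintro _ hdL - hLcons ⟨U, hU, rfl⟩
    congr 1
    funext t
    ext1 f
    rw [hΦ.classicalGroup_apply]
    refine hΦ.apply_eq_comp_of_isConservative hGL hU hLcons (fun g hg y hy => ?_) t f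
    have hgd : g ∈ d.domain := hd.1 ▸ hg
    have h1 := (d.le_closure.trans hdL)
    -- Both generators extend d, so on polynomials they take the same value, the derivative along
    -- the flow.
    have h2 : generator U ⟨g, h1.1 hgd⟩ = y := by
      rw [← h1.2 (x := ⟨g, hgd⟩) (y := ⟨g, h1.1 hgd⟩) rfl,
        hle.2 (x := ⟨g, hgd⟩) (y := ⟨g, hle.1 hgd⟩) rfl]
      have h3 : HasDerivAt
          (fun t => classicalGroup (fun s t => hΦ.homeo (t - s)) t g) y 0 := by
        simpa only [hΦ.classicalGroup_apply] using hy
      exact h3.deriv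
    have h4 := hasDerivAt_generator_zero (U := U) ⟨g, h1.1 hgd⟩
    rwa [h2] at h4
  · intro hh
    have hh' : complexify h ∈ polynomials (Set.univ : Set X) :=
      Algebra.adjoin_mono (Set.image_mono (Set.subset_univ _)) hh
    obtain ⟨W, hW, -⟩ := exists_hasWeight_pairing hh'
    have hWG : W = G := ContinuousMap.ext fun ρ => ((hW ρ).stateGradient_eq).symm
    exact le_antisymm hle' (hΦ.generator_le_closure hd.1 hle hcl hh' (hWG ▸ hW))
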